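/- Let $G$ be a (Hausdorff, second countable) real Lie group of dimension $d$ with neutral element $e$, let $X_1,\dots,X_d$ be a basis of its Lie algebra, acting on functions as left-invariant vector fields, and let $x_1,\dots,x_d\in C_c^\infty(G)$ be canonical co-ordinate functions at $e$; that is, on some open neighbourhood $U$ of $e$ the map $(x_1,\dots,x_d)$ is a homeomorphism onto an open neighbourhood of $0$ in $\mathbb R^d$, with $x_i(e)=0$ and $g=\exp\big(\sum_i x_i(g)X_i\big)$ for $g\in U$ (call such a $U$ a canonical co-ordinate neighbourhood). A Lévy measure on $G$ is a Borel measure $\nu$ with $\nu(\{e\})=0$ such that $\int_V\sum_i y_i^2\,d\nu<\infty$ and $\nu(V^c)<\infty$ for every canonical co-ordinate neighbourhood $V$ of $e$ with canonical co-ordinate functions $y_1,\dots,y_d\in C_c^\infty(G)$ on $V$; a Lévy kernel is a family $\mu=(\mu(g,\cdot))_{g\in G}$ of Lévy measures. A Lévy kernel $\mu$ is associated to an operator $A$ from $C_c^\infty(G)$ to the real functions on $G$ if there are functions $c\ge 0$ and $b_i$ on $G$, and a function $a=(a_{jk})$ on $G$ with values in the symmetric non-negative definite $d\times d$ matrices,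 such that for all $f\in C_c^\infty(G)$ and $\sigma\in G$ $$Af(\sigma)=-c(\sigma)f(\sigma)+\sum_{i}b_i(\sigma)X_if(\sigma)+\sum_{j,k}a_{jk}(\sigma)X_jX_kf(\sigma)+\int_G\Big(f(\sigma\tau)-f(\sigma)-\sum_i x_i(\tau)X_if(\sigma)\Big)\mu(\sigma,d\tau).$$ Let $(p_t)_{t\ge0}$ be the transition probabilities of a Feller process on $G$: Markov kernels with $p_0(\sigma,\cdot)=\delta_\sigma$ which satisfy the Chapman–Kolmogorov equations and for which the operators $T_tf(\sigma)=\int_G f(\tau)\,p_t(\sigma,d\tau)$ map $C_0(G)$ into itself, with $\|T_tf-f\|_\infty\to0$ as $t\to0$ for all $f\in C_0(G)$. Let $A$ be its generator, $Af=\lim_{t\to0}(T_tf-f)/t$ in $C_0(G)$, and assume that $C_c^\infty(G)\subseteq\mathrm{Dom}(A)$. Then there is exactly one Lévy kernel $\mu$ associated to the restriction of $A$ to $C_c^\infty(G)$, and for all $g\in G$ and all $f\in C_c^\infty(G)$ that vanish on a neighbourhood of $g$, the function $\tau\mapsto f(g\tau)$ is $\mu(g,\cdot)$-integrable and $$\lim_{t\to0}\frac1t\int_G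 f(\tau)\,p_t(g,d\tau)=\int_G f(g\tau)\,\mu(g,d\tau).$$ -/

import Mathlib

open MeasureTheory ProbabilityTheory Filter Topology
open scoped Manifold ContDiff NNReal ZeroAtInfty

noncomputable section

section LieGroups

variable {d : ℕ} {G : Type*} [TopologicalSpace G] [ChartedSpace (EuclideanSpace ℝ (Fin d)) G]

variable (d G) in
/-- `C_c^∞(G)`: the smooth real-valued functions with compact support. -/
def SmoothCc : Type _ :=
  {f : G → ℝ // ContMDiff (𝓡 d) 𝓘(ℝ) ∞ f ∧ HasCompactSupport f}

instance : CoeFun (SmoothCc d G) fun _ => G → ℝ := ⟨Subtype.val⟩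

/-- The inclusion of `C_c^∞(G)` into the Banach space `C₀(G)` (with the supremum norm). -/
def SmoothCc.toC0 (f : SmoothCc d G) : C₀(G, ℝ) where
  toFun := f
  continuous_toFun := f.2.1.continuous
  zero_at_infty' := f.2.2.is_zero_at_infty

variable [Group G]

/-- The action `(v f)(g)` on functions of the left-invariant vector field determined by the
element `v` of the Lie algebra. -/
def leftInvariantDeriv (v : GroupLieAlgebra (𝓡 d) G) (f : G → ℝ) (g : G) : ℝ :=
  mfderiv (𝓡 d) 𝓘(ℝ) f g (mulInvariantVectorField v g)

/-- `g = exp v`: the integral curve through the neutral element of the left-invariant vector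
field determined by `v` is at `g` at time `1`. -/
def IsLieExp (v : GroupLieAlgebra (𝓡 d) G) (g : G) : Prop :=
  ∃ γ : ℝ → G, γ 0 = 1 ∧ IsMIntegralCurve (I := 𝓡 d) γ (mulInvariantVectorField v) ∧ γ 1 = g

/-- `U` is an open canonical co-ordinate neighbourhood of the neutral element, relative to the
basis `X` of the Lie algebra, with co-ordinate functions `x 1, …, x d`: on `U` they give a
homeomorphism onto an open neighbourhood of `0` in `ℝ^d` whose inverse is
`(a₁, …, a_d) ↦ exp (∑ aᵢ Xᵢ)`. As usual the co-ordinate functions are taken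
to be (the restrictions to `U` of) functions in `C_c^∞(G)`. -/
structure IsCanonicalCoordinates (X : Module.Basis (Fin d) ℝ (GroupLieAlgebra (𝓡 d) G))
    (U : Set G) (x : Fin d → SmoothCc d G) : Prop where
  isOpen : IsOpen U
  one_mem : (1 : G) ∈ U
  map_one : ∀ i, x i 1 = 0
  isOpenEmbedding : IsOpenEmbedding (U.domRestrict fun g => fun i => x i g)
  exp_eq : ∀ g ∈ U, IsLieExp (∑ i, x i g • X i) g

variable [MeasurableSpace G]

/-- A Borel measure `ν` on `G` is a Lévy measure if `ν {e} = 0` and, for every canonical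
co-ordinate neighbourhood `U` of `e`, `∫_U ∑ xᵢ² dν < ∞` and `ν (Uᶜ) < ∞`. -/
structure IsLevyMeasure (X : Module.Basis (Fin d) ℝ (GroupLieAlgebra (𝓡 d) G))
    (ν : Measure G) : Prop where
  singleton_one : ν {1} = 0
  lintegral_lt_top : ∀ U x, IsCanonicalCoordinates X U x →
    ∫⁻ g in U, ENNReal.ofReal (∑ i, x i g ^ 2) ∂ν < ⊤
  compl_lt_top : ∀ U x, IsCanonicalCoordinates X U x → ν Uᶜ < ⊤

/-- A Lévy kernel assigns to each point of `G` a Lévy measure. -/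
def IsLevyKernel (X : Module.Basis (Fin d) ℝ (GroupLieAlgebra (𝓡 d) G))
    (μ : G → Measure G) : Prop :=
  ∀ g, IsLevyMeasure X (μ g)

/-- `μ` is the Lévy kernel associated to the operator `A : C_c^∞(G) → ℱ(G)`: for some functions
`c ≥ 0`, `b` and some symmetric non-negative definite matrix-valued `a`, the operator `A` is
the Lévy-type operator with characteristics `(c, b, a, μ)`. -/
def IsAssociatedLevyKernel (X : Module.Basis (Fin d) ℝ (GroupLieAlgebra (𝓡 d) G))
    (x : Fin d → SmoothCc d G) (A : SmoothCc d G → G → ℝ) (μ : G → Measure G) : Prop :=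
  IsLevyKernel X μ ∧
  ∃ (c : G → ℝ) (b : G → Fin d → ℝ) (a : G → Matrix (Fin d) (Fin d) ℝ),
    (∀ σ, 0 ≤ c σ) ∧ (∀ σ, (a σ).PosSemidef) ∧
    ∀ (f : SmoothCc d G) (σ : G),
      A f σ = -c σ * f σ + ∑ i, b σ i * leftInvariantDeriv (X i) f σ
        + ∑ j, ∑ k, a σ j k * leftInvariantDeriv (X j) (leftInvariantDeriv (X k) f) σ
        + ∫ τ, (f (σ * τ) - f σ - ∑ i, x i τ * leftInvariantDeriv (X i) f σ) ∂(μ σ)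

end LieGroups

section Feller

variable {G : Type*} [TopologicalSpace G] [MeasurableSpace G]

/-- The operators `T_t f (σ) = ∫ f(τ) p_t(σ, dτ)`. -/
def transitionOp (p : ℝ≥0 → Kernel G G) (t : ℝ≥0) (f : G → ℝ) (σ : G) : ℝ :=
  ∫ τ, f τ ∂(p t σ)

/-- `p` is the transition function of a (conservative, time-homogeneous) Feller process: Markov
kernels with `p_0(σ, ·) = δ_σ` and the Chapman–Kolmogorov equations, such that the operators
`T_t` leave `C₀(G)` invariant and `‖T_t f - f‖_∞ → 0` as `t → 0` for all `f` in `C₀(G)`. -/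
structure IsFellerTransition (p : ℝ≥0 → Kernel G G) : Prop where
  isMarkovKernel : ∀ t, IsMarkovKernel (p t)
  zero : p 0 = Kernel.id
  chapman_kolmogorov : ∀ s t, p (s + t) = p t ∘ₖ p s
  map_C0 : ∀ (t : ℝ≥0) (f : C₀(G, ℝ)), ∃ h : C₀(G, ℝ), ∀ σ, h σ = transitionOp p t f σ
  tendsto_zero : ∀ f : C₀(G, ℝ), TendstoUniformly (fun t => transitionOp p t f) f (𝓝[>] 0)

/-- `‖(T_t f - f) / t - h‖_∞ → 0` as `t → 0`. -/
def IsGeneratorLimit (p : ℝ≥0 → Kernel G G) (f h : C₀(G, ℝ)) : Prop :=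
  TendstoUniformly (fun (t : ℝ≥0) σ => (t : ℝ)⁻¹ * (transitionOp p t f σ - f σ)) h (𝓝[>] 0)

/-- The domain of the infinitesimal generator of `(T_t)` on `C₀(G)`. -/
def generatorDomain (p : ℝ≥0 → Kernel G G) : Set C₀(G, ℝ) :=
  {f | ∃ h, IsGeneratorLimit p f h}

open Classical in
/-- The infinitesimal generator of `(T_t)` on `C₀(G)`: on its domain, `A f` is the (unique)
uniform limit of `(T_t f - f) / t` as `t → 0`. Outside the domain the value `0` has no meaning. -/
def generator (p : ℝ≥0 → Kernel G G) (f : C₀(G, ℝ)) : C₀(G, ℝ) :=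
  if h : f ∈ generatorDomain p then h.choose else 0

end Feller

end

/-! Fix $g$ and move to the neutral element: with $m_t$ the image of $p_t(g,\cdot)$ under
$\tau\mapsto g^{-1}\tau$, the generator provides $L(f)=\lim_{t\to0} t^{-1}(\int f\,dm_t-f(e))$ for
every $f\in C_c^\infty(G)$. Existence is the Lévy–Khintchine form of such limits
(`exists_levyKhintchine_of_tendsto`). Take $w=\sum x_i^2+1-\varphi$ with $\varphi$ a bump at $e$; it
vanishes only at $e$, and $t^{-1}\int w\,dm_t$ converges. The measures $w\,t^{-1}m_t$ thus have
bounded mass and a vague limit, and dividing that limit by $w$ off $e$ gives $\nu$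
(`exists_measure_of_weighted_bound`).

Compactly supported functions that are $o(w)$ at $e$ pass to the limit exactly. The second-order
Taylor remainder in canonical co-ordinates is one
(`IsCanonicalCoordinates.eventually_abs_taylor_le`), so $L$ of it is its $\nu$-integral. What the
limit loses at $e$ is the matrix $a$; what it loses at infinity is $c$. Both are non-negative by
lower semicontinuity.

Uniqueness and the limit formula share one identity (`IsAssociatedLevyKernel.apply_eq_integral`): if
$f$ vanishes near $g$, the local terms drop out and $Af(g)=\int f(g\tau)\,\mu(g,d\tau)$. Such $f$
determine $\mu(g,\cdot)$ off $e$, where all its mass lies. -/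

noncomputable section

/-! ### Left-invariant derivatives and the exponential relation. -/

section LieExp

variable {d : ℕ} {G : Type*} [TopologicalSpace G] [ChartedSpace (EuclideanSpace ℝ (Fin d)) G]
  [Group G]

lemma leftInvariantDeriv_add (v w : GroupLieAlgebra (𝓡 d) G) (f : G → ℝ) :
    leftInvariantDeriv (v + w) f = leftInvariantDeriv v f + leftInvariantDeriv w f := by
  ext g
  simp only [leftInvariantDeriv, mulInvariantVectorField_add, Pi.add_apply]
  exact map_add (mfderiv (𝓡 d) 𝓘(ℝ) f g) _ _

lemma leftInvariantDeriv_smul (c : ℝ) (v : GroupLieAlgebra (𝓡 d) G) (f : G → ℝ) :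
    leftInvariantDeriv (c • v) f = c • leftInvariantDeriv v f := by
  ext g
  simp only [leftInvariantDeriv, mulInvariantVectorField_smul, Pi.smul_apply]
  exact map_smul (mfderiv (𝓡 d) 𝓘(ℝ) f g) _ _

lemma leftInvariantDeriv_sum_smul {ι : Type*} (s : Finset ι) (c : ι → ℝ)
    (v : ι → GroupLieAlgebra (𝓡 d) G) (f : G → ℝ) (g : G) :
    leftInvariantDeriv (∑ i ∈ s, c i • v i) f g = ∑ i ∈ s, c i * leftInvariantDeriv (v i) f g := by
  classical
  induction s using Finset.induction_on with
  | empty =>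
    have := congrFun (leftInvariantDeriv_smul (0 : ℝ) (0 : GroupLieAlgebra (𝓡 d) G) f) g
    simpa using this
  | insert a s ha ih =>
    rw [Finset.sum_insert ha, Finset.sum_insert ha, leftInvariantDeriv_add,
      leftInvariantDeriv_smul, Pi.add_apply, ih]
    rfl

/-- The derivative of a function along an integral curve of a left-invariant vector field. -/
lemma IsMIntegralCurve.hasDerivAt_comp {v : GroupLieAlgebra (𝓡 d) G} {γ : ℝ → G}
    (hγ : IsMIntegralCurve (I := 𝓡 d) γ (mulInvariantVectorField v)) {f : G → ℝ}
    (hf : MDifferentiable (𝓡 d) 𝓘(ℝ) f) (s : ℝ) :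
    HasDerivAt (fun s => f (γ s)) (leftInvariantDeriv v f (γ s)) s := by
  obtain ⟨L, hL, hL1⟩ : ∃ L : ℝ →L[ℝ] ℝ, HasFDerivAt (fun s => f (γ s)) L s ∧
      L 1 = leftInvariantDeriv v f (γ s) := by
    refine ⟨_, hasMFDerivAt_iff_hasFDerivAt.1 ((hf (γ s)).hasMFDerivAt.comp s (hγ s)), ?_⟩
    change mfderiv (𝓡 d) 𝓘(ℝ) f (γ s) ((1 : ℝ) • mulInvariantVectorField v (γ s)) = _
    rw [one_smul]
    rfl
  exact hL1 ▸ hL.hasDerivAt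

lemma isLieExp_smul_of_isMIntegralCurve {v : GroupLieAlgebra (𝓡 d) G} {γ : ℝ → G} (h0 : γ 0 = 1)
    (hγ : IsMIntegralCurve (I := 𝓡 d) γ (mulInvariantVectorField v)) (s : ℝ) :
    IsLieExp (s • v) (γ s) := by
  refine ⟨γ ∘ (· * s), by simpa using h0, ?_, by simp⟩
  rw [mulInvariantVectorField_smul]
  exact hγ.comp_mul s

variable [LieGroup (𝓡 d) ∞ G]

lemma lieGroup_minSmoothness_three : LieGroup (𝓡 d) (minSmoothness ℝ 3) G := by
  rw [minSmoothness_of_isRCLikeNormedField]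
  exact LieGroup.of_le (n := ∞) ENat.LEInfty.out

lemma mfderiv_mul_left_mulInvariantVectorField (v : GroupLieAlgebra (𝓡 d) G) (g h : G) :
    mfderiv (𝓡 d) (𝓡 d) (g * ·) h (mulInvariantVectorField v h) =
      mulInvariantVectorField v (g * h) := by
  have D : (fun x => g * h * x) = (fun x => g * x) ∘ (fun x => h * x) := by
    ext x; simp [mul_assoc]
  have hd : ∀ a b : G, MDifferentiableAt (𝓡 d) (𝓡 d) (a * ·) b := fun a b =>
    (contMDiff_mul_left (I := 𝓡 d) (n := ∞)).contMDiffAt.mdifferentiableAt (by simp)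
  simp only [mulInvariantVectorField]
  rw [D, mfderiv_comp (I' := 𝓡 d) _ (hd _ _) (hd _ _)]
  -- The base points `h * 1` and `h` are only propositionally equal. Ascribing maps of the model
  -- space, to which all tangent spaces unfold, allows the rewrite.
  exact congrArg (fun y => (mfderiv (𝓡 d) (𝓡 d) (g * ·) y :
    EuclideanSpace ℝ (Fin d) →L[ℝ] EuclideanSpace ℝ (Fin d))
      (mfderiv (𝓡 d) (𝓡 d) (h * ·) 1 v)) (mul_one h).symm

lemma leftInvariantDeriv_comp_mul_left (v : GroupLieAlgebra (𝓡 d) G) {f : G → ℝ}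
    (hf : MDifferentiable (𝓡 d) 𝓘(ℝ) f) (g : G) :
    leftInvariantDeriv v (fun τ => f (g * τ)) = fun τ => leftInvariantDeriv v f (g * τ) := by
  ext τ
  have hd : MDifferentiableAt (𝓡 d) (𝓡 d) (g * ·) τ :=
    (contMDiff_mul_left (I := 𝓡 d) (n := ∞)).contMDiffAt.mdifferentiableAt (by simp)
  have := mfderiv_comp (I' := 𝓡 d) τ (hf (g * τ)) hd
  simp only [leftInvariantDeriv]
  rw [show (fun τ => f (g * τ)) = f ∘ (g * ·) from rfl, this,
    ← mfderiv_mul_left_mulInvariantVectorField]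
  rfl

lemma contMDiff_mulInvariantVectorField_two (v : GroupLieAlgebra (𝓡 d) G) :
    ContMDiff (𝓡 d) (𝓡 d).tangent 2
      (fun g : G => (mulInvariantVectorField v g : TangentBundle (𝓡 d) G)) := by
  have := lieGroup_minSmoothness_three (d := d) (G := G)
  have := contMDiff_mulInvariantVectorField (I := 𝓡 d) v
  exact this.of_le (by rw [minSmoothness_of_isRCLikeNormedField])

lemma contMDiff_leftInvariantDeriv (v : GroupLieAlgebra (𝓡 d) G) {f : G → ℝ} {m n : ℕ∞ω}
    (hf : ContMDiff (𝓡 d) 𝓘(ℝ) n f) (hmn : m + 1 ≤ n) (hm : m ≤ 2) :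
    ContMDiff (𝓡 d) 𝓘(ℝ) m (leftInvariantDeriv v f) := by
  have : IsManifold (𝓡 d) (1 : ℕ∞ω) G := IsManifold.of_le (n := ∞) ENat.LEInfty.out
  have h1 : ContMDiff (𝓡 d) _ m
      (tangentMap (𝓡 d) 𝓘(ℝ) f ∘ fun g : G =>
        (mulInvariantVectorField v g : TangentBundle (𝓡 d) G)) :=
    (hf.contMDiff_tangentMap hmn).comp ((contMDiff_mulInvariantVectorField_two v).of_le hm)
  exact (contMDiff_snd_tangentBundle_modelSpace ℝ 𝓘(ℝ)).comp h1

lemma contMDiff_leftInvariantDeriv_two (v : GroupLieAlgebra (𝓡 d) G) {f : G → ℝ}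
    (hf : ContMDiff (𝓡 d) 𝓘(ℝ) ∞ f) : ContMDiff (𝓡 d) 𝓘(ℝ) 2 (leftInvariantDeriv v f) :=
  contMDiff_leftInvariantDeriv v (hf.of_le (m := 3) ENat.LEInfty.out)
    (by norm_num) le_rfl

lemma continuous_leftInvariantDeriv_leftInvariantDeriv (v w : GroupLieAlgebra (𝓡 d) G) {f : G → ℝ}
    (hf : ContMDiff (𝓡 d) 𝓘(ℝ) ∞ f) : Continuous (leftInvariantDeriv v (leftInvariantDeriv w f)) :=
  (contMDiff_leftInvariantDeriv v (m := 1) (contMDiff_leftInvariantDeriv_two w hf)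
    (by norm_num) (by norm_num)).continuous

variable [T2Space G]

lemma IsMIntegralCurve.eq_of_mulInvariantVectorField {v : GroupLieAlgebra (𝓡 d) G} {γ γ' : ℝ → G}
    (hγ : IsMIntegralCurve (I := 𝓡 d) γ (mulInvariantVectorField v))
    (hγ' : IsMIntegralCurve (I := 𝓡 d) γ' (mulInvariantVectorField v)) (h : γ 0 = γ' 0) :
    γ = γ' := by
  have : IsManifold (𝓡 d) (1 : ℕ∞ω) G := IsManifold.of_le (n := ∞) ENat.LEInfty.out
  exact isMIntegralCurve_Ioo_eq_of_contMDiff_boundaryless (t₀ := 0)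
    ((contMDiff_mulInvariantVectorField_two v).of_le (by norm_num)) hγ hγ' h

/-- Uniqueness of integral curves makes the exponential single-valued; points of the group are
identified below through this. -/
lemma IsLieExp.eq {v : GroupLieAlgebra (𝓡 d) G} {g g' : G} (h : IsLieExp v g)
    (h' : IsLieExp v g') : g = g' := by
  obtain ⟨γ, h0, hγ, rfl⟩ := h
  obtain ⟨γ', h0', hγ', rfl⟩ := h'
  rw [hγ.eq_of_mulInvariantVectorField hγ' (h0.trans h0'.symm)]

end LieExp

/-! ### Canonical co-ordinates and the second-order Taylor expansion. -/

section CanonicalCoordinates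

/-- Taylor's formula of order two with the Lagrange form of the remainder. -/
lemma exists_eq_add_add_half_of_hasDerivAt {φ φ' φ'' : ℝ → ℝ} (h1 : ∀ s, HasDerivAt φ (φ' s) s)
    (h2 : ∀ s, HasDerivAt φ' (φ'' s) s) :
    ∃ ξ ∈ Set.Ioo (0 : ℝ) 1, φ 1 = φ 0 + φ' 0 + 1 / 2 * φ'' ξ := by
  -- With this `K`, the function `φ s - φ' 0 * s - K * s ^ 2` agrees at 0 and 1, and its derivative
  -- vanishes at 0. Rolle's theorem, used twice, gives `φ'' ξ = 2 * K`.
  set K := φ 1 - φ 0 - φ' 0 with hK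
  have d1 : ∀ s, HasDerivAt (fun s => φ s - φ' 0 * s - K * s ^ 2) (φ' s - φ' 0 - K * (2 * s)) s := by
    intro s
    exact (((h1 s).fun_sub ((hasDerivAt_id' s).const_mul (φ' 0))).fun_sub
      ((hasDerivAt_pow 2 s).const_mul K)).congr_deriv (by simp)
  have d2 : ∀ s, HasDerivAt (fun s => φ' s - φ' 0 - K * (2 * s)) (φ'' s - K * 2) s := by
    intro s
    exact (((h2 s).sub_const (φ' 0)).fun_sub
      (((hasDerivAt_id' s).const_mul 2).const_mul K)).congr_deriv (by simp)
  obtain ⟨c, hc, hc0⟩ := exists_hasDerivAt_eq_zero zero_lt_one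
    (fun s _ => (d1 s).continuousAt.continuousWithinAt) (by simp [hK]) (fun s _ => d1 s)
  obtain ⟨ξ, hξ, hξ0⟩ := exists_hasDerivAt_eq_zero hc.1
    (fun s _ => (d2 s).continuousAt.continuousWithinAt) (by rw [hc0]; simp) (fun s _ => d2 s)
  exact ⟨ξ, ⟨hξ.1, hξ.2.trans hc.2⟩, by linarith⟩

variable {d : ℕ} {G : Type*} [TopologicalSpace G] [ChartedSpace (EuclideanSpace ℝ (Fin d)) G]

lemma SmoothCc.continuous (f : SmoothCc d G) : Continuous f := f.2.1.continuous

lemma SmoothCc.continuous_family (x : Fin d → SmoothCc d G) :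
    Continuous (fun g => fun i => x i g : G → Fin d → ℝ) :=
  continuous_pi fun i => (x i).continuous

variable [Group G] {X : Module.Basis (Fin d) ℝ (GroupLieAlgebra (𝓡 d) G)} {U : Set G}
  {x : Fin d → SmoothCc d G}

namespace IsCanonicalCoordinates

lemma injOn (hx : IsCanonicalCoordinates X U x) : Set.InjOn (fun g => fun i => x i g) U := by
  intro a ha b hb h
  exact congrArg Subtype.val (hx.isOpenEmbedding.toIsEmbedding.injective
    (a₁ := ⟨a, ha⟩) (a₂ := ⟨b, hb⟩) h)

lemma coord_one (hx : IsCanonicalCoordinates X U x) : (fun i => x i 1) = (0 : Fin d → ℝ) :=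
  funext hx.map_one

lemma exists_forall_mem (hx : IsCanonicalCoordinates X U x) :
    ∃ r > 0, ∀ a : Fin d → ℝ, ‖a‖ < r → ∃ τ ∈ U, (fun i => x i τ) = a := by
  have h0 : (0 : Fin d → ℝ) ∈ Set.range (U.domRestrict fun g => fun i => x i g) :=
    ⟨⟨1, hx.one_mem⟩, hx.coord_one⟩
  obtain ⟨r, hr, h⟩ := Metric.isOpen_iff.1 hx.isOpenEmbedding.isOpen_range _ h0
  refine ⟨r, hr, fun a ha => ?_⟩
  obtain ⟨⟨τ, hτ⟩, rfl⟩ := h (mem_ball_zero_iff.2 ha)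
  exact ⟨τ, hτ, rfl⟩

/-- Continuity at 0 of the inverse chart. Membership in `U` is essential, since the co-ordinate
functions may also be small far from the neutral element. -/
lemma exists_forall_norm_lt_mem (hx : IsCanonicalCoordinates X U x) {N : Set G} (hN : N ∈ 𝓝 1) :
    ∃ δ > 0, ∀ τ ∈ U, ‖(fun i => x i τ : Fin d → ℝ)‖ < δ → τ ∈ N := by
  have h : (Subtype.val ⁻¹' N : Set U) ∈ 𝓝 (⟨1, hx.one_mem⟩ : U) :=
    continuous_subtype_val.continuousAt.preimage_mem_nhds hN
  rw [hx.isOpenEmbedding.toIsInducing.nhds_eq_comap, Filter.mem_comap] at h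
  obtain ⟨t, ht, hsub⟩ := h
  have e : (U.domRestrict fun g => fun i => x i g) ⟨1, hx.one_mem⟩ = (0 : Fin d → ℝ) := hx.coord_one
  rw [e] at ht
  obtain ⟨δ, hδ, hb⟩ := Metric.mem_nhds_iff.1 ht
  exact ⟨δ, hδ, fun τ hτ hn => hsub (show (⟨τ, hτ⟩ : U) ∈ _ from hb (mem_ball_zero_iff.2 hn))⟩

lemma eventually_norm_coord_lt (hx : IsCanonicalCoordinates X U x) {r : ℝ} (hr : 0 < r) :
    ∀ᶠ τ in 𝓝 (1 : G), ‖(fun i => x i τ : Fin d → ℝ)‖ < r := by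
  have h := (SmoothCc.continuous_family x).norm.tendsto 1
  rw [hx.coord_one, norm_zero] at h
  exact h.eventually_lt_const hr

lemma eventually_mem (hx : IsCanonicalCoordinates X U x) : ∀ᶠ τ in 𝓝 (1 : G), τ ∈ U :=
  hx.isOpen.mem_nhds hx.one_mem

lemma sum_sq_eq_zero_iff (hx : IsCanonicalCoordinates X U x) {τ : G} (hτ : τ ∈ U) :
    ∑ i, x i τ ^ 2 = 0 ↔ τ = 1 := by
  refine ⟨fun h => hx.injOn hτ hx.one_mem ?_, fun h => by simp [h, hx.map_one]⟩
  rw [Finset.sum_eq_zero_iff_of_nonneg fun i _ => sq_nonneg _] at h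
  funext i
  simpa [hx.map_one] using h i (Finset.mem_univ i)

variable [LieGroup (𝓡 d) ∞ G] [T2Space G]

/-- `U` need not be star-shaped, but the co-ordinate image contains a ball. The point with
co-ordinates `s • x τ` therefore exists in `U`; it and `γ s` are exponentials of the same vector,
hence equal. -/
lemma exists_curve (hx : IsCanonicalCoordinates X U x) : ∃ r > 0, ∀ τ ∈ U,
    ‖(fun i => x i τ : Fin d → ℝ)‖ < r → ∃ γ : ℝ → G, γ 0 = 1 ∧ γ 1 = τ ∧
      IsMIntegralCurve (I := 𝓡 d) γ (mulInvariantVectorField (∑ i, x i τ • X i)) ∧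
      ∀ s ∈ Set.Icc (0 : ℝ) 1, γ s ∈ U ∧ (fun i => x i (γ s)) = s • (fun i => x i τ) := by
  obtain ⟨r, hr, h⟩ := hx.exists_forall_mem
  refine ⟨r, hr, fun τ hτ hn => ?_⟩
  obtain ⟨γ, h0, hγ, h1⟩ := hx.exp_eq τ hτ
  refine ⟨γ, h0, h1, hγ, fun s hs => ?_⟩
  obtain ⟨η, hη, e⟩ := h (s • fun i => x i τ) (by
    rw [norm_smul, Real.norm_of_nonneg hs.1]
    exact (mul_le_of_le_one_left (norm_nonneg _) hs.2).trans_lt hn)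
  have h2 := isLieExp_smul_of_isMIntegralCurve h0 hγ s
  have h3 := hx.exp_eq η hη
  have e2 : ∑ i, x i η • X i = s • ∑ i, x i τ • X i := by
    rw [Finset.smul_sum]
    refine Finset.sum_congr rfl fun i _ => ?_
    rw [show x i η = s * x i τ from congrFun e i, mul_smul]
  rw [e2] at h3
  rw [h2.eq h3]
  exact ⟨hη, e⟩

/-- Canonical co-ordinates relative to the same basis agree near the neutral element. -/
lemma eventually_eq (hx : IsCanonicalCoordinates X U x) {V : Set G} {y : Fin d → SmoothCc d G}
    (hy : IsCanonicalCoordinates X V y) : ∀ᶠ τ in 𝓝 (1 : G), ∀ i, x i τ = y i τ := by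
  obtain ⟨r, hr, h⟩ := hx.exists_forall_mem
  filter_upwards [hx.eventually_mem, hy.eventually_mem, hy.eventually_norm_coord_lt hr]
    with τ hU hV hn
  -- `η` is the point of `U` whose `x`-co-ordinates are the `y`-co-ordinates of `τ`; both are
  -- exponentials of the same vector.
  obtain ⟨η, hη, e⟩ := h _ hn
  have h3 := hx.exp_eq η hη
  have e2 : ∑ i, x i η • X i = ∑ i, y i τ • X i :=
    Finset.sum_congr rfl fun i _ => by rw [show x i η = y i τ from congrFun e i]
  rw [e2] at h3
  obtain rfl := (hy.exp_eq τ hV).eq h3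
  exact congrFun e

/-- The second order Taylor expansion at the neutral element in canonical co-ordinates. -/
lemma eventually_abs_taylor_le (hx : IsCanonicalCoordinates X U x) {f : G → ℝ}
    (hf : ContMDiff (𝓡 d) 𝓘(ℝ) ∞ f) {ε : ℝ} (hε : 0 < ε) :
    ∀ᶠ τ in 𝓝 (1 : G), |f τ - f 1 - ∑ i, x i τ * leftInvariantDeriv (X i) f 1 -
      1 / 2 * ∑ j, ∑ k, x j τ * x k τ * leftInvariantDeriv (X j) (leftInvariantDeriv (X k) f) 1| ≤
        ε * ∑ i, x i τ ^ 2 := by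
  set D : Fin d → Fin d → G → ℝ :=
    fun j k => leftInvariantDeriv (X j) (leftInvariantDeriv (X k) f) with hD
  have hDc : ∀ j k, Continuous (D j k) := fun j k =>
    continuous_leftInvariantDeriv_leftInvariantDeriv _ _ hf
  -- The division absorbs the factor `d` in `(∑ |x j|) ^ 2 ≤ d * ∑ x j ^ 2`; the `+ 1` covers `d =
  -- 0`.
  have hε' : 0 < ε / (d + 1) := by positivity
  have hN : {η : G | ∀ j k, |D j k η - D j k 1| < ε / (d + 1)} ∈ 𝓝 (1 : G) := by
    refine Filter.eventually_all.2 fun j => Filter.eventually_all.2 fun k => ?_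
    have := (hDc j k).tendsto 1
    rw [Metric.tendsto_nhds] at this
    exact this _ hε'
  obtain ⟨δ, hδ, hδN⟩ := hx.exists_forall_norm_lt_mem hN
  obtain ⟨r, hr, hcurve⟩ := hx.exists_curve
  filter_upwards [hx.eventually_mem, hx.eventually_norm_coord_lt hr,
    hx.eventually_norm_coord_lt hδ] with τ hτ hτr hτδ
  obtain ⟨γ, h0, h1, hγ, hs⟩ := hcurve τ hτ hτr
  have hf1 : MDifferentiable (𝓡 d) 𝓘(ℝ) f := hf.mdifferentiable (by simp)
  have d1 : ∀ s, HasDerivAt (fun s => f (γ s))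
      (∑ i, x i τ * leftInvariantDeriv (X i) f (γ s)) s := fun s => by
    have := hγ.hasDerivAt_comp hf1 s
    rwa [leftInvariantDeriv_sum_smul] at this
  have d2 : ∀ s, HasDerivAt (fun s => ∑ i, x i τ * leftInvariantDeriv (X i) f (γ s))
      (∑ k, x k τ * ∑ j, x j τ * D j k (γ s)) s := fun s => by
    refine HasDerivAt.fun_sum fun k _ => HasDerivAt.const_mul _ ?_
    have := hγ.hasDerivAt_comp
      ((contMDiff_leftInvariantDeriv_two (X k) hf).mdifferentiable (by simp)) s
    rwa [leftInvariantDeriv_sum_smul] at this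
  -- Along the one-parameter curve to `τ` the coefficients `x i τ` are constant, so Taylor's formula
  -- in one variable produces the iterated Lie derivatives, the second ones at `γ ξ`. Their
  -- continuity controls the error.
  obtain ⟨ξ, hξ, hT⟩ := exists_eq_add_add_half_of_hasDerivAt d1 d2
  simp only [h0, h1] at hT
  obtain ⟨hξU, hξx⟩ := hs ξ ⟨hξ.1.le, hξ.2.le⟩
  have hξN := hδN (γ ξ) hξU (by
    rw [hξx, norm_smul, Real.norm_of_nonneg hξ.1.le]
    exact (mul_le_of_le_one_left (norm_nonneg _) hξ.2.le).trans_lt hτδ)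
  have key : f τ - f 1 - ∑ i, x i τ * leftInvariantDeriv (X i) f 1 -
      1 / 2 * ∑ j, ∑ k, x j τ * x k τ * D j k 1 =
      1 / 2 * ∑ j, ∑ k, x j τ * x k τ * (D j k (γ ξ) - D j k 1) := by
    have e1 : ∑ k, x k τ * ∑ j, x j τ * D j k (γ ξ) =
        ∑ j, ∑ k, x j τ * x k τ * D j k (γ ξ) := by
      rw [Finset.sum_comm]
      refine Finset.sum_congr rfl fun k _ => ?_
      rw [Finset.mul_sum]
      exact Finset.sum_congr rfl fun j _ => by ring
    simp only [mul_sub, Finset.sum_sub_distrib]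
    rw [hT, e1]
    ring
  rw [key, abs_mul, abs_of_pos (by norm_num : (0 : ℝ) < 1 / 2)]
  have b1 : |∑ j, ∑ k, x j τ * x k τ * (D j k (γ ξ) - D j k 1)| ≤
      ε / (d + 1) * (∑ j, |x j τ|) ^ 2 := by
    rw [sq, Finset.sum_mul_sum, Finset.mul_sum]
    refine (Finset.abs_sum_le_sum_abs _ _).trans (Finset.sum_le_sum fun j _ => ?_)
    rw [Finset.mul_sum]
    refine (Finset.abs_sum_le_sum_abs _ _).trans (Finset.sum_le_sum fun k _ => ?_)
    rw [abs_mul, abs_mul, mul_comm]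
    exact mul_le_mul_of_nonneg_right (hξN j k).le (by positivity)
  have b2 : (∑ j, |x j τ|) ^ 2 ≤ d * ∑ j, x j τ ^ 2 := by
    have := sq_sum_le_card_mul_sum_sq (s := Finset.univ) (f := fun j => |x j τ|)
    simpa using this
  have hS : 0 ≤ ∑ j, x j τ ^ 2 := Finset.sum_nonneg fun _ _ => sq_nonneg _
  calc 1 / 2 * |∑ j, ∑ k, x j τ * x k τ * (D j k (γ ξ) - D j k 1)|
      ≤ 1 / 2 * (ε / (d + 1) * (d * ∑ j, x j τ ^ 2)) := by
        gcongr
        exact b1.trans (mul_le_mul_of_nonneg_left b2 hε'.le)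
    _ = (1 / 2 * (d / (d + 1))) * (ε * ∑ j, x j τ ^ 2) := by ring
    _ ≤ 1 * (ε * ∑ j, x j τ ^ 2) := by
        gcongr
        have : (d : ℝ) / (d + 1) ≤ 1 := (div_le_one (by positivity)).2 (by linarith)
        linarith
    _ = _ := one_mul _

end IsCanonicalCoordinates

end CanonicalCoordinates

/-! ### Vague limits of weighted measures. -/

section VagueCompactness

open scoped CompactlySupported

variable {S : Type*} [TopologicalSpace S] [T2Space S] [LocallyCompactSpace S]
  [MeasurableSpace S] [BorelSpace S] {ι : Type*} {l : Filter ι} [l.NeBot]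

/-- A family of measures of bounded mass has a vague limit along an ultrafilter. -/
lemma exists_ultrafilter_tendsto_integral (κ : ι → Measure S) [∀ i, IsFiniteMeasure (κ i)] {M : ℝ}
    (hM : ∀ᶠ i in l, (κ i).real Set.univ ≤ M) :
    ∃ (m : Measure S) (𝒰 : Ultrafilter ι), IsFiniteMeasure m ∧ (𝒰 : Filter ι) ≤ l ∧
      ∀ f : S → ℝ, Continuous f → HasCompactSupport f →
        Tendsto (fun i => ∫ s, f s ∂(κ i)) 𝒰 (𝓝 (∫ s, f s ∂m)) := by
  set 𝒰 := Ultrafilter.of l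
  have h𝒰 : (𝒰 : Filter ι) ≤ l := Ultrafilter.of_le l
  have hb : ∀ (f : C_c(S, ℝ)) (C : ℝ), 0 ≤ C → (∀ s, |f s| ≤ C) →
      ∀ᶠ i in l, |∫ s, f s ∂(κ i)| ≤ C * M := by
    intro f C hC hf
    filter_upwards [hM] with i hi
    have := norm_integral_le_of_norm_le_const (μ := κ i) 
      (ae_of_all _ fun s => (Real.norm_eq_abs (f s)).trans_le (hf s))
    exact this.trans (mul_le_mul_of_nonneg_left hi hC)
  -- Along an ultrafilter a bounded real family converges, so all test functions are handled at
  -- once. The limits form a positive functional, to which the Riesz–Markov–Kakutani theorem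
  -- applies.
  have hlim : ∀ f : C_c(S, ℝ), ∃ y, Tendsto (fun i => ∫ s, f s ∂(κ i)) 𝒰 (𝓝 y) := by
    intro f
    obtain ⟨C, hC⟩ := f.hasCompactSupport.exists_bound_of_continuous f.continuous
    have h1 := hb f (max C 0) (le_max_right _ _) fun s => (hC s).trans (le_max_left _ _)
    obtain ⟨y, -, hy⟩ := (isCompact_Icc (a := -(max C 0 * M)) (b := max C 0 * M)).ultrafilter_le_nhds
      (𝒰.map fun i => ∫ s, f s ∂(κ i))
      (by
        rw [le_principal_iff]
        exact h𝒰 (h1.mono fun i hi => abs_le.1 hi))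
    exact ⟨y, hy⟩
  choose Λ₀ hΛ₀ using hlim
  let Λ : C_c(S, ℝ) →ₚ[ℝ] ℝ :=
  { toFun := Λ₀
    map_add' f g := tendsto_nhds_unique (hΛ₀ (f + g)) (((hΛ₀ f).add (hΛ₀ g)).congr fun i =>
      (integral_add f.integrable g.integrable).symm)
    map_smul' c f := tendsto_nhds_unique (hΛ₀ (c • f)) (((hΛ₀ f).const_mul c).congr fun i =>
      (integral_const_mul c f).symm)
    monotone' f g hfg := le_of_tendsto_of_tendsto' (hΛ₀ f) (hΛ₀ g) fun i =>
      integral_mono f.integrable g.integrable hfg }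
  have hΛ : ∀ f, Λ f = Λ₀ f := fun f => rfl
  refine ⟨RealRMK.rieszMeasure Λ, 𝒰, ⟨?_⟩, h𝒰, fun f hf hfc => ?_⟩
  · rw [isOpen_univ.measure_eq_iSup_isCompact]
    refine lt_of_le_of_lt (b := ENNReal.ofReal M) ?_ ENNReal.ofReal_lt_top
    refine iSup₂_le fun K _ => iSup_le fun hK => ?_
    obtain ⟨f, hf1, -, hfc, hf01⟩ := exists_continuous_one_zero_of_isCompact hK isClosed_empty
      (Set.disjoint_empty K)
    let f' : C_c(S, ℝ) := ⟨f, hfc⟩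
    refine (RealRMK.rieszMeasure_le_of_eq_one Λ (f := f') (fun s => (hf01 s).1) hK hf1).trans ?_
    refine ENNReal.ofReal_le_ofReal (le_of_tendsto (hΛ₀ f') ?_)
    have := hb f' 1 zero_le_one fun s => abs_le.2
      ⟨neg_one_lt_zero.le.trans (hf01 s).1, (hf01 s).2⟩
    filter_upwards [h𝒰 this] with i hi
    linarith [(abs_le.1 hi).2]
  · have := hΛ₀ ⟨⟨f, hf⟩, hfc⟩
    rw [← hΛ, ← RealRMK.integral_rieszMeasure] at this
    exact this

/-- Vague limits away from a point `e` of finite measures against which a function `w` that is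
positive off `e` has bounded integrals. -/
lemma exists_measure_of_weighted_bound [SigmaCompactSpace S] (ν : ι → Measure S)
    [∀ i, IsFiniteMeasure (ν i)] {e : S} {w : S → ℝ} (hw : Continuous w) (hw0 : ∀ s, 0 ≤ w s)
    (hwe : ∀ s, w s = 0 ↔ s = e) (hwi : ∀ i, Integrable w (ν i)) {M : ℝ}
    (hM : ∀ᶠ i in l, ∫ s, w s ∂(ν i) ≤ M) :
    ∃ μ : Measure S, μ {e} = 0 ∧ Integrable w μ ∧
      (∀ h : S → ℝ, Continuous h → HasCompactSupport h →
        (∀ ε > 0, ∀ᶠ s in 𝓝 e, |h s| ≤ ε * w s) → Integrable h μ ∧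
          ∀ y, Tendsto (fun i => ∫ s, h s ∂(ν i)) l (𝓝 y) → ∫ s, h s ∂μ = y) ∧
      (∀ h : S → ℝ, Continuous h → (∀ s, 0 ≤ h s) → (∃ C, ∀ s, h s ≤ C * w s) → Integrable h μ ∧
          ∀ y, Tendsto (fun i => ∫ s, h s ∂(ν i)) l (𝓝 y) → ∫ s, h s ∂μ ≤ y) := by
  set W : S → ℝ≥0 := fun s => Real.toNNReal (w s) with hW
  have hWm : Measurable W := hw.measurable.real_toNNReal
  have hWc : ∀ s, (W s : ℝ) = w s := fun s => Real.coe_toNNReal _ (hw0 s)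
  set κ : ι → Measure S := fun i => (ν i).withDensity fun s => (W s : ENNReal) with hκ
  have hκu : ∀ i, κ i Set.univ = ENNReal.ofReal (∫ s, w s ∂(ν i)) := fun i => by
    rw [hκ, withDensity_apply _ MeasurableSet.univ, setLIntegral_univ,
      ofReal_integral_eq_lintegral_ofReal (hwi i) (ae_of_all _ hw0)]
    rfl
  have : ∀ i, IsFiniteMeasure (κ i) := fun i => ⟨by rw [hκu]; exact ENNReal.ofReal_lt_top⟩
  obtain ⟨m, 𝒰, hm, h𝒰, hlim⟩ := exists_ultrafilter_tendsto_integral κ (l := l) (M := M) (by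
    filter_upwards [hM] with i hi
    rw [measureReal_def, hκu, ENNReal.toReal_ofReal (integral_nonneg hw0)]
    exact hi)
  -- An atom of `m` at `e` is discarded here: `w e = 0` and `0⁻¹ = 0`.
  set μ : Measure S := m.withDensity fun s => ((W s)⁻¹ : ℝ≥0) with hμ
  have hWi : Measurable fun s => (W s)⁻¹ := hWm.inv
  have hμint : ∀ h : S → ℝ, ∫ s, h s ∂μ = ∫ s, h s / w s ∂m := fun h => by
    rw [hμ, integral_withDensity_eq_integral_smul hWi]
    refine integral_congr_ae (ae_of_all _ fun s => ?_)
    simp only [NNReal.smul_def, NNReal.coe_inv, hWc, smul_eq_mul]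
    ring
  have hwμ : Integrable w μ := by
    rw [hμ, integrable_withDensity_iff_integrable_smul hWi]
    refine Integrable.of_bound (C := 1) (Measurable.aestronglyMeasurable ?_) (ae_of_all _ fun s => ?_)
    · exact hWi.smul hw.measurable
    · simp only [NNReal.smul_def, NNReal.coe_inv, hWc, smul_eq_mul, Real.norm_eq_abs]
      rw [abs_of_nonneg (mul_nonneg (inv_nonneg.2 (hw0 s)) (hw0 s))]
      exact inv_mul_le_one
  have hdom : ∀ h : S → ℝ, Continuous h → (∃ C, ∀ s, |h s| ≤ C * w s) → Integrable h μ := by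
    rintro h hc ⟨C, hC⟩
    exact (hwμ.const_mul C).mono' hc.aestronglyMeasurable (ae_of_all _ hC)
  have hfirst : ∀ h : S → ℝ, Continuous h → HasCompactSupport h →
      (∀ ε > 0, ∀ᶠ s in 𝓝 e, |h s| ≤ ε * w s) → Integrable h μ ∧
        Tendsto (fun i => ∫ s, h s ∂(ν i)) 𝒰 (𝓝 (∫ s, h s ∂μ)) := by
    intro h hc hcs ho
    have he : h e = 0 := by
      have := (ho 1 one_pos).self_of_nhds
      rw [(hwe e).2 rfl, mul_zero] at this
      exact abs_nonpos_iff.1 this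
    -- Since `h = o(w)` at `e`, the quotient, equal to 0 at `e` by the division convention, is a
    -- legitimate test function for the vague limit of the weighted measures.
    have hF : Continuous fun s => h s / w s := by
      rw [continuous_iff_continuousAt]
      intro s
      by_cases hs : s = e
      · subst hs
        rw [ContinuousAt, he, zero_div, Metric.tendsto_nhds]
        intro ε hε
        filter_upwards [ho (ε / 2) (half_pos hε)] with s hs
        rw [dist_zero_right, Real.norm_eq_abs, abs_div, abs_of_nonneg (hw0 s)]
        exact (div_le_of_le_mul₀ (hw0 s) (half_pos hε).le hs).trans_lt (half_lt_self hε)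
      · exact hc.continuousAt.div hw.continuousAt (mt (hwe s).1 hs)
    have hFs : HasCompactSupport fun s => h s / w s :=
      hcs.mono fun s hs hs0 => hs (by simp [hs0])
    have hFw : ∀ s, h s = w s * (h s / w s) := fun s => by
      by_cases hs : s = e
      · subst hs; simp [he]
      · rw [mul_div_cancel₀ _ (mt (hwe s).1 hs)]
    obtain ⟨C, hC⟩ := hFs.exists_bound_of_continuous hF
    refine ⟨hdom h hc ⟨C, fun s => ?_⟩, ?_⟩
    · rw [hFw s, abs_mul, abs_of_nonneg (hw0 s), mul_comm]
      exact mul_le_mul_of_nonneg_right (hC s) (hw0 s)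
    · rw [hμint]
      refine (hlim _ hF hFs).congr fun i => ?_
      rw [hκ, integral_withDensity_eq_integral_smul hWm]
      refine integral_congr_ae (ae_of_all _ fun s => ?_)
      simp only [NNReal.smul_def, hWc, smul_eq_mul]
      exact (hFw s).symm
  refine ⟨μ, ?_, hwμ, fun h hc hcs ho => ?_, ?_⟩
  · rw [hμ, withDensity_apply _ (measurableSet_singleton e), lintegral_singleton]
    simp [hW, (hwe e).2 rfl]
  · obtain ⟨h1, h2⟩ := hfirst h hc hcs ho
    exact ⟨h1, fun y hy => tendsto_nhds_unique h2 (hy.mono_left h𝒰)⟩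
  · rintro h hc h0 ⟨C, hC⟩
    have hi : Integrable h μ := hdom h hc ⟨C, fun s => by rw [abs_of_nonneg (h0 s)]; exact hC s⟩
    refine ⟨hi, fun y hy => ?_⟩
    let K : CompactExhaustion S := default
    have hk : ∀ n, ∃ k : C(S, ℝ), Set.EqOn k 1 (K n) ∧ HasCompactSupport k ∧
        ∀ s, k s ∈ Set.Icc (0 : ℝ) 1 := fun n => by
      obtain ⟨k, h1, -, h2, h3⟩ := exists_continuous_one_zero_of_isCompact (K.isCompact n)
        isClosed_empty (Set.disjoint_empty _)
      exact ⟨k, h1, h2, h3⟩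
    choose k hk1 hkc hk01 using hk
    -- The factor `k n` gives compact support, and `min 1 (n * w s)` makes `h * χ n` at most `C * n
    -- * w ^ 2`, hence `o(w)` at `e`. Off `e` the cut-offs are eventually 1, and `h e = 0`.
    set χ : ℕ → S → ℝ := fun n s => min 1 (n * w s) * k n s with hχ
    have hχ0 : ∀ n s, 0 ≤ χ n s := fun n s =>
      mul_nonneg (le_min zero_le_one (mul_nonneg n.cast_nonneg (hw0 s))) (hk01 n s).1
    have hχ1 : ∀ n s, χ n s ≤ 1 := fun n s =>
      mul_le_one₀ (min_le_left _ _) (hk01 n s).1 (hk01 n s).2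
    have hχc : ∀ n, Continuous (χ n) := fun n =>
      (continuous_const.min (continuous_const.mul hw)).mul (k n).continuous
    have hhχ : ∀ n s, h s * χ n s ≤ h s := fun n s => mul_le_of_le_one_right (h0 s) (hχ1 n s)
    have hhi : ∀ i, Integrable h (ν i) := fun i =>
      ((hwi i).const_mul C).mono' hc.aestronglyMeasurable (ae_of_all _ fun s => by
        rw [Real.norm_eq_abs, abs_of_nonneg (h0 s)]; exact hC s)
    have hle : ∀ n, ∫ s, h s * χ n s ∂μ ≤ y := fun n => by
      have hcont : Continuous fun s => h s * χ n s := hc.mul (hχc n)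
      have h2 := (hfirst (fun s => h s * χ n s) hcont
        ((hkc n).mul_left.mul_left) fun ε hε => ?_).2
      · refine le_of_tendsto_of_tendsto' h2 (hy.mono_left h𝒰) fun i => ?_
        refine integral_mono ((hhi i).mono' hcont.aestronglyMeasurable (ae_of_all _ fun s => ?_))
          (hhi i) (hhχ n)
        rw [Real.norm_eq_abs, abs_of_nonneg (mul_nonneg (h0 s) (hχ0 n s))]
        exact hhχ n s
      · have ht : Tendsto (fun s => C * (n * w s)) (𝓝 e) (𝓝 0) := by
          have : Continuous fun s => C * (n * w s) := by fun_prop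
          simpa [(hwe e).2 rfl] using this.tendsto e
        filter_upwards [ht.eventually_lt_const hε] with s hs
        rw [abs_of_nonneg (mul_nonneg (h0 s) (hχ0 n s))]
        have h3 : χ n s ≤ n * w s :=
          (mul_le_of_le_one_right (le_min zero_le_one (mul_nonneg n.cast_nonneg (hw0 s)))
            (hk01 n s).2).trans (min_le_right _ _)
        calc h s * χ n s ≤ (C * w s) * (n * w s) :=
              mul_le_mul (hC s) h3 (hχ0 n s) ((h0 s).trans (hC s))
          _ = C * (n * w s) * w s := by ring
          _ ≤ ε * w s := mul_le_mul_of_nonneg_right hs.le (hw0 s)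
    refine le_of_tendsto' (tendsto_integral_of_dominated_convergence h
      (fun n => (hc.mul (hχc n)).aestronglyMeasurable) hi (fun n => ae_of_all _ fun s => ?_)
      (ae_of_all _ fun s => ?_)) hle
    · exact (abs_of_nonneg (mul_nonneg (h0 s) (hχ0 n s))).trans_le (hhχ n s)
    · by_cases hs : s = e
      · have : h s = 0 := le_antisymm (by simpa [(hwe s).2 hs] using hC s) (h0 s)
        simp [this]
      · refine tendsto_const_nhds.congr' ?_
        have hws : 0 < w s := (hw0 s).lt_of_ne fun h => hs ((hwe s).1 h.symm)
        obtain ⟨N, hN⟩ := K.exists_mem s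
        obtain ⟨N', hN'⟩ := exists_nat_ge (w s)⁻¹
        filter_upwards [eventually_ge_atTop N, eventually_ge_atTop N'] with n hn hn'
        have h1 : 1 ≤ (n : ℝ) * w s := by
          have : (w s)⁻¹ ≤ n := hN'.trans (by exact_mod_cast hn')
          exact (inv_le_iff_one_le_mul₀ hws).1 this
        simp [hχ, min_eq_left h1, hk1 n (K.subset hn hN)]

end VagueCompactness

/-! ### Elementary operations and bump functions in $C_c^\infty$. -/

section Bump

variable {d : ℕ} {G : Type*} [TopologicalSpace G] [ChartedSpace (EuclideanSpace ℝ (Fin d)) G]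

/-- The pointwise product in `C_c^∞(G)`. -/
def SmoothCc.mul (f g : SmoothCc d G) : SmoothCc d G :=
  ⟨fun τ => f τ * g τ, f.2.1.mul g.2.1, f.2.2.mul_right⟩

lemma SmoothCc.mul_apply (f g : SmoothCc d G) (τ : G) : f.mul g τ = f τ * g τ := rfl

lemma SmoothCc.integrable [MeasurableSpace G] [BorelSpace G] [SecondCountableTopology G]
    (f : SmoothCc d G) (ν : Measure G) [IsFiniteMeasure ν] :
    Integrable f ν :=
  f.continuous.integrable_of_hasCompactSupport f.2.2

lemma SmoothCc.exists_bound (f : SmoothCc d G) : ∃ C, 0 ≤ C ∧ ∀ τ, |f τ| ≤ C := by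
  obtain ⟨C, hC⟩ := HasCompactSupport.exists_bound_of_continuous f.2.2 f.continuous
  exact ⟨max C 0, le_max_right _ _, fun τ => (hC τ).trans (le_max_left _ _)⟩

lemma exists_smoothCc_eq_one [T2Space G] [SecondCountableTopology G] [IsManifold (𝓡 d) ∞ G]
    {K U : Set G} (hK : IsCompact K) (hU : IsOpen U) (hKU : K ⊆ U) :
    ∃ φ : SmoothCc d G, (∀ᶠ τ in 𝓝ˢ K, φ τ = 1) ∧ (∀ τ ∉ U, φ τ = 0) ∧
      ∀ τ, φ τ ∈ Set.Icc (0 : ℝ) 1 := by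
  have := ChartedSpace.locallyCompactSpace (EuclideanSpace ℝ (Fin d)) G
  obtain ⟨K', hK', hKK', hK'U⟩ := exists_compact_between hK hU hKU
  obtain ⟨φ, h1, h0, h01⟩ := exists_contMDiffMap_one_nhds_of_subset_interior (𝓡 d) (n := ⊤)
    hK.isClosed hKK'
  refine ⟨⟨φ, φ.contMDiff, ?_⟩, h1, fun τ hτ => h0 τ fun h => hτ (hK'U h), h01⟩
  exact HasCompactSupport.intro hK' h0

end Bump

/-! ### Finiteness properties of Lévy measures. -/

section LevyMeasure

variable {d : ℕ} {G : Type*} [TopologicalSpace G] [ChartedSpace (EuclideanSpace ℝ (Fin d)) G]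
  [Group G] [MeasurableSpace G] {X : Module.Basis (Fin d) ℝ (GroupLieAlgebra (𝓡 d) G)}
  {U : Set G} {x : Fin d → SmoothCc d G} {ν : Measure G}

/-- Markov's inequality: on `U` outside `N` the sum of squares is at least some `δ ^ 2 > 0`. -/
lemma IsCanonicalCoordinates.measure_compl_lt_top [BorelSpace G]
    (hx : IsCanonicalCoordinates X U x)
    (h1 : ∫⁻ g in U, ENNReal.ofReal (∑ i, x i g ^ 2) ∂ν < ⊤) (h2 : ν Uᶜ < ⊤) {N : Set G}
    (hN : N ∈ 𝓝 1) : ν Nᶜ < ⊤ := by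
  obtain ⟨δ, hδ, h⟩ := hx.exists_forall_norm_lt_mem hN
  have hsub : Nᶜ ⊆ Uᶜ ∪ ({τ | ENNReal.ofReal (δ ^ 2) ≤ ENNReal.ofReal (∑ i, x i τ ^ 2)} ∩ U) := by
    intro τ hτ
    by_cases hU : τ ∈ U
    · refine Or.inr ⟨ENNReal.ofReal_le_ofReal ?_, hU⟩
      by_contra! hlt
      refine hτ (h τ hU ((pi_norm_lt_iff hδ).2 fun i => ?_))
      refine (sq_lt_sq₀ (norm_nonneg _) hδ.le).1 (lt_of_le_of_lt ?_ hlt)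
      rw [Real.norm_eq_abs, sq_abs]
      exact Finset.single_le_sum (f := fun i => x i τ ^ 2) (fun i _ => sq_nonneg _)
        (Finset.mem_univ i)
    · exact Or.inl hU
  have hm : AEMeasurable (fun τ => ENNReal.ofReal (∑ i, x i τ ^ 2)) (ν.restrict U) := by
    have : Continuous fun τ => ∑ i, x i τ ^ 2 :=
      continuous_finsetSum _ fun i _ => (x i).continuous.pow 2
    exact this.measurable.ennreal_ofReal.aemeasurable
  refine (measure_mono hsub).trans_lt ((measure_union_le _ _).trans_lt
    (ENNReal.add_lt_top.2 ⟨h2, ?_⟩))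
  rw [← Measure.restrict_apply' hx.isOpen.measurableSet]
  have h0 : ENNReal.ofReal (δ ^ 2) ≠ 0 := (ENNReal.ofReal_pos.2 (by positivity)).ne'
  refine (meas_ge_le_lintegral_div hm h0 ENNReal.ofReal_ne_top).trans_lt ?_
  exact ENNReal.div_lt_top h1.ne h0

lemma IsLevyMeasure.measure_compl_lt_top [BorelSpace G] (hν : IsLevyMeasure X ν)
    (hx : IsCanonicalCoordinates X U x) {N : Set G} (hN : N ∈ 𝓝 1) : ν Nᶜ < ⊤ :=
  hx.measure_compl_lt_top (hν.lintegral_lt_top U x hx) (hν.compl_lt_top U x hx) hN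

lemma integrable_of_eventually_eq_zero [BorelSpace G] (hν : ∀ N ∈ 𝓝 (1 : G), ν Nᶜ < ⊤)
    {f : G → ℝ} (hf : Continuous f) {C : ℝ} (hC : ∀ τ, |f τ| ≤ C)
    (h0 : ∀ᶠ τ in 𝓝 (1 : G), f τ = 0) : Integrable f ν := by
  obtain ⟨N, hN, hNo, h1⟩ := eventually_nhds_iff.1 h0
  have hs : Function.support f ⊆ Nᶜ := fun τ hτ hτN => hτ (hN τ hτN)
  rw [← integrableOn_iff_integrable_of_support_subset hs]
  refine Measure.integrableOn_of_bounded (M := C) (hν N (hNo.mem_nhds h1)).ne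
    hf.measurable.aestronglyMeasurable (ae_of_all _ fun τ => ?_)
  rw [Real.norm_eq_abs]
  exact hC τ

/-- It suffices to check the conditions on a Lévy measure in one canonical co-ordinate
neighbourhood. -/
lemma IsCanonicalCoordinates.isLevyMeasure [BorelSpace G] [LieGroup (𝓡 d) ∞ G] [T2Space G]
    (hx : IsCanonicalCoordinates X U x) (h0 : ν {1} = 0)
    (h1 : ∫⁻ g in U, ENNReal.ofReal (∑ i, x i g ^ 2) ∂ν < ⊤) (h2 : ν Uᶜ < ⊤) :
    IsLevyMeasure X ν := by
  refine ⟨h0, fun V y hy => ?_, fun V y hy =>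
    hx.measure_compl_lt_top h1 h2 (hy.isOpen.mem_nhds hy.one_mem)⟩
  obtain ⟨W, hW, hWo, h1W⟩ := eventually_nhds_iff.1 (hx.eventually_eq hy)
  have hb : ∃ C : ℝ, ∀ τ, ∑ i, y i τ ^ 2 ≤ C := by
    choose C _ hC using fun i => (y i).exists_bound
    refine ⟨∑ i, C i ^ 2, fun τ => Finset.sum_le_sum fun i _ => ?_⟩
    rw [← sq_abs]
    exact pow_le_pow_left₀ (abs_nonneg _) (hC i τ) 2
  obtain ⟨C, hC⟩ := hb
  have hWU : MeasurableSet (W ∩ U) := (hWo.inter hx.isOpen).measurableSet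
  refine (setLIntegral_le_lintegral V _).trans_lt ?_
  -- On `W ∩ U` the two co-ordinate systems agree; off this neighbourhood `ν` is finite and the `y
  -- i` are bounded.
  rw [← lintegral_add_compl _ hWU]
  refine ENNReal.add_lt_top.2 ⟨?_, ?_⟩
  · calc ∫⁻ g in W ∩ U, ENNReal.ofReal (∑ i, y i g ^ 2) ∂ν
        = ∫⁻ g in W ∩ U, ENNReal.ofReal (∑ i, x i g ^ 2) ∂ν :=
          setLIntegral_congr_fun hWU fun τ hτ => by simp only [hW τ hτ.1]
      _ ≤ ∫⁻ g in U, ENNReal.ofReal (∑ i, x i g ^ 2) ∂ν :=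
          lintegral_mono_set Set.inter_subset_right
      _ < ⊤ := h1
  · calc ∫⁻ g in (W ∩ U)ᶜ, ENNReal.ofReal (∑ i, y i g ^ 2) ∂ν
        ≤ ∫⁻ _ in (W ∩ U)ᶜ, ENNReal.ofReal C ∂ν :=
          lintegral_mono fun τ => ENNReal.ofReal_le_ofReal (hC τ)
      _ = ENNReal.ofReal C * ν (W ∩ U)ᶜ := by rw [setLIntegral_const]
      _ < ⊤ := ENNReal.mul_lt_top ENNReal.ofReal_lt_top (hx.measure_compl_lt_top h1 h2
          ((hWo.inter hx.isOpen).mem_nhds ⟨h1W, hx.one_mem⟩))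

end LevyMeasure

/-! ### The Lévy–Khintchine form of the limit functional. -/

section LevyKhintchine

variable {d : ℕ} {G : Type*} [TopologicalSpace G] [T2Space G] [SecondCountableTopology G]
  [ChartedSpace (EuclideanSpace ℝ (Fin d)) G] [Group G] [LieGroup (𝓡 d) ∞ G]
  [MeasurableSpace G] [BorelSpace G] {X : Module.Basis (Fin d) ℝ (GroupLieAlgebra (𝓡 d) G)}
  {U : Set G} {x : Fin d → SmoothCc d G}

/-- If `f ↦ t⁻¹ (∫ f dm_t - f(e))` converges on `C_c^∞(G)` as `t → 0`, for probability
measures `m_t`, then the limit is a functional of Lévy–Khintchine form. -/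
lemma exists_levyKhintchine_of_tendsto (hx : IsCanonicalCoordinates X U x) (m : ℝ≥0 → Measure G)
    [∀ t, IsProbabilityMeasure (m t)] (L : SmoothCc d G → ℝ)
    (hL : ∀ f : SmoothCc d G, Tendsto (fun t : ℝ≥0 => (t : ℝ)⁻¹ * (∫ τ, f τ ∂(m t) - f 1))
      (𝓝[>] 0) (𝓝 (L f))) :
    ∃ ν : Measure G, IsLevyMeasure X ν ∧
      ∃ (c : ℝ) (b : Fin d → ℝ) (a : Matrix (Fin d) (Fin d) ℝ), 0 ≤ c ∧ a.PosSemidef ∧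
        ∀ f : SmoothCc d G, L f = -c * f 1 + ∑ i, b i * leftInvariantDeriv (X i) f 1
          + ∑ j, ∑ k, a j k * leftInvariantDeriv (X j) (leftInvariantDeriv (X k) f) 1
          + ∫ τ, (f τ - f 1 - ∑ i, x i τ * leftInvariantDeriv (X i) f 1) ∂ν := by
  have := ChartedSpace.locallyCompactSpace (EuclideanSpace ℝ (Fin d)) G
  have hi : ∀ (f : SmoothCc d G) t, Integrable f (m t) := fun f t => f.integrable (m t)
  obtain ⟨φ, hφ1, hφU, hφ01⟩ := exists_smoothCc_eq_one (d := d) (isCompact_singleton (x := (1 : G)))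
    hx.isOpen (Set.singleton_subset_iff.2 hx.one_mem)
  rw [nhdsSet_singleton] at hφ1
  have hφe : φ 1 = 1 := hφ1.self_of_nhds
  set q : G → ℝ := fun τ => ∑ i, x i τ ^ 2 with hq
  have hq0 : ∀ τ, 0 ≤ q τ := fun τ => Finset.sum_nonneg fun i _ => sq_nonneg _
  have hqc : Continuous q := continuous_finsetSum _ fun i _ => (x i).continuous.pow 2
  -- `q` alone may vanish away from 1; the term `1 - φ` repairs this outside `U` and is 0 near 1, so
  -- `w = q` there.
  set w : G → ℝ := fun τ => q τ + (1 - φ τ) with hw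
  have hφ0 : ∀ τ, 0 ≤ 1 - φ τ := fun τ => sub_nonneg.2 (hφ01 τ).2
  have hw0 : ∀ τ, 0 ≤ w τ := fun τ => add_nonneg (hq0 τ) (hφ0 τ)
  have hqw : ∀ τ, q τ ≤ w τ := fun τ => le_add_of_nonneg_right (hφ0 τ)
  have hφw : ∀ τ, 1 - φ τ ≤ w τ := fun τ => le_add_of_nonneg_left (hq0 τ)
  have hwc : Continuous w := hqc.add (continuous_const.sub φ.continuous)
  have hwe : ∀ τ, w τ = 0 ↔ τ = 1 := fun τ => by
    refine ⟨fun h => ?_, fun h => by simp [hw, hq, h, hφe, hx.map_one]⟩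
    have h1 : q τ = 0 := le_antisymm (h ▸ hqw τ) (hq0 τ)
    have h2 : 1 - φ τ = 0 := le_antisymm (h ▸ hφw τ) (hφ0 τ)
    refine (hx.sum_sq_eq_zero_iff ?_).1 h1
    by_contra hU
    simp [hφU τ hU] at h2
  set P : Fin d → Fin d → SmoothCc d G := fun j k => (x j).mul (x k) with hP
  have hP1 : ∀ j k, P j k 1 = 0 := fun j k => by simp [hP, SmoothCc.mul_apply, hx.map_one]
  have hqP : ∀ τ, q τ = ∑ i, P i i τ := fun τ =>
    Finset.sum_congr rfl fun i _ => by simp [hP, SmoothCc.mul_apply, sq]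
  set ν' : ℝ≥0 → Measure G := fun t => t⁻¹ • m t with hν'
  have hint : ∀ (t : ℝ≥0) (f : G → ℝ), ∫ τ, f τ ∂(ν' t) = (t : ℝ)⁻¹ * ∫ τ, f τ ∂(m t) :=
    fun t f => by
      rw [hν', integral_smul_nnreal_measure, NNReal.smul_def, smul_eq_mul, NNReal.coe_inv]
  have hI : ∀ (f : SmoothCc d G) t, Integrable f (ν' t) := fun f t => f.integrable _
  have hIφ : ∀ t, Integrable (fun τ => 1 - φ τ) (ν' t) := fun t =>
    (integrable_const _).sub (hI φ t)
  have hL0 : ∀ f : SmoothCc d G, f 1 = 0 →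
      Tendsto (fun t => ∫ τ, f τ ∂(ν' t)) (𝓝[>] 0) (𝓝 (L f)) := fun f hf =>
    (hL f).congr fun t => by rw [hint, hf, sub_zero]
  -- `1 - φ` need not lie in $C_c^\infty$, but the `m t` have total mass 1, so its integrals are
  -- governed by `φ`.
  have hLφ : Tendsto (fun t => ∫ τ, (1 - φ τ) ∂(ν' t)) (𝓝[>] 0) (𝓝 (-L φ)) :=
    (hL φ).neg.congr fun t => by
      rw [hint, integral_sub (integrable_const _) (hi φ t), hφe]
      simp
      ring
  have hIq : ∀ t, Integrable q (ν' t) := fun t => by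
    simp only [funext hqP]
    exact integrable_finsetSum _ fun i _ => hI (P i i) t
  have hLq : Tendsto (fun t => ∫ τ, q τ ∂(ν' t)) (𝓝[>] 0) (𝓝 (∑ i, L (P i i))) := by
    refine (tendsto_finsetSum _ fun i _ => hL0 (P i i) (hP1 i i)).congr fun t => ?_
    rw [← integral_finsetSum _ fun i _ => hI (P i i) t]
    simp only [hqP]
  have hLw : Tendsto (fun t => ∫ τ, w τ ∂(ν' t)) (𝓝[>] 0) (𝓝 (∑ i, L (P i i) + -L φ)) :=
    (hLq.add hLφ).congr fun t => (integral_add (hIq t) (hIφ t)).symm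
  obtain ⟨ν, hν1, hwν, H1, H2⟩ := exists_measure_of_weighted_bound (l := 𝓝[>] (0 : ℝ≥0)) ν' hwc hw0
    hwe (fun t => (hIq t).add (hIφ t)) (hLw.eventually_le_const (lt_add_one _))
  have hwφ : ∀ᶠ τ in 𝓝 (1 : G), w τ = q τ := by
    filter_upwards [hφ1] with τ hτ
    simp [hw, hτ]
  have hPν : ∀ j k, Integrable (P j k) ν := fun j k =>
    hwν.mono' (P j k).continuous.aestronglyMeasurable (ae_of_all _ fun τ => by
      refine le_trans ?_ (hqw τ)
      have hj := Finset.single_le_sum (f := fun i => x i τ ^ 2) (fun i _ => sq_nonneg _)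
        (Finset.mem_univ j)
      have hk := Finset.single_le_sum (f := fun i => x i τ ^ 2) (fun i _ => sq_nonneg _)
        (Finset.mem_univ k)
      rw [Real.norm_eq_abs, hP, SmoothCc.mul_apply, abs_le]
      simp only [hq]
      constructor <;> nlinarith [sq_nonneg (x j τ + x k τ), sq_nonneg (x j τ - x k τ)])
  obtain ⟨hφν, hφle⟩ := H2 (fun τ => 1 - φ τ) (continuous_const.sub φ.continuous) hφ0
    ⟨1, fun τ => by rw [one_mul]; exact hφw τ⟩
  -- Half the second moments lost in the limit by concentration at 1.
  set a : Matrix (Fin d) (Fin d) ℝ :=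
    Matrix.of fun j k => 1 / 2 * (L (P j k) - ∫ τ, P j k τ ∂ν) with ha
  have haij : ∀ j k, a j k = 1 / 2 * (L (P j k) - ∫ τ, P j k τ ∂ν) := fun j k => rfl
  refine ⟨ν, hx.isLevyMeasure hν1 ?_ ?_, -L φ - ∫ τ, (1 - φ τ) ∂ν, fun i => L (x i), a, ?_, ?_, ?_⟩
  · refine lt_of_le_of_lt ?_ ((hasFiniteIntegral_iff_ofReal (ae_of_all _ hw0)).1 hwν.2)
    exact (setLIntegral_le_lintegral _ _).trans
      (lintegral_mono fun τ => ENNReal.ofReal_le_ofReal (hqw τ))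
  · refine (measure_mono fun τ hτ => ?_).trans_lt (hwν.measure_norm_ge_lt_top one_pos)
    have := hφw τ
    rw [hφU τ hτ, sub_zero] at this
    exact this.trans (Real.le_norm_self _)
  · exact sub_nonneg.2 (hφle _ hLφ)
  · refine Matrix.PosSemidef.of_dotProduct_mulVec_nonneg ?_ fun ξ => ?_
    · ext j k
      have : P k j = P j k := Subtype.ext (funext fun τ => mul_comm _ _)
      simp [haij, this]
    -- The quadratic form of `a` at `ξ` is half the loss for the integrand `(∑ ξ j * x j) ^ 2`,
    -- which is bounded by a multiple of `w`; lower semicontinuity gives the sign.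
    · set h : G → ℝ := fun τ => (∑ j, ξ j * x j τ) ^ 2 with hh
      have hhP : ∀ τ, h τ = ∑ j, ∑ k, ξ j * ξ k * P j k τ := fun τ => by
        simp only [hh, sq, Finset.sum_mul_sum, hP, SmoothCc.mul_apply]
        exact Finset.sum_congr rfl fun j _ => Finset.sum_congr rfl fun k _ => by ring
      have hhi : ∀ ρ : Measure G, (∀ j k, Integrable (P j k) ρ) →
          ∫ τ, h τ ∂ρ = ∑ j, ∑ k, ξ j * ξ k * ∫ τ, P j k τ ∂ρ := fun ρ hρ => by
        simp only [hhP]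
        rw [integral_finsetSum _ fun j _ => integrable_finsetSum _ fun k _ => (hρ j k).const_mul _]
        refine Finset.sum_congr rfl fun j _ => ?_
        rw [integral_finsetSum _ fun k _ => (hρ j k).const_mul _]
        exact Finset.sum_congr rfl fun k _ => integral_const_mul _ _
      have hle := (H2 h ((continuous_finsetSum _ fun j _ =>
        continuous_const.mul (x j).continuous).pow 2) (fun τ => sq_nonneg _)
        ⟨∑ j, ξ j ^ 2, fun τ => (Finset.sum_mul_sq_le_sq_mul_sq _ _ _).trans
          (mul_le_mul_of_nonneg_left (hqw τ) (Finset.sum_nonneg fun j _ => sq_nonneg _))⟩).2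
        (∑ j, ∑ k, ξ j * ξ k * L (P j k)) ((tendsto_finsetSum _ fun j _ =>
          tendsto_finsetSum _ fun k _ => (hL0 (P j k) (hP1 j k)).const_mul _).congr fun t =>
            (hhi _ fun j k => hI (P j k) t).symm)
      rw [hhi ν hPν, ← sub_nonneg, ← Finset.sum_sub_distrib] at hle
      have e : star ξ ⬝ᵥ a.mulVec ξ = 1 / 2 * ∑ j, (∑ k, ξ j * ξ k * L (P j k) -
          ∑ k, ξ j * ξ k * ∫ τ, P j k τ ∂ν) := by
        simp only [dotProduct, Matrix.mulVec, star_trivial, haij, Finset.mul_sum,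
          ← Finset.sum_sub_distrib]
        exact Finset.sum_congr rfl fun j _ => Finset.sum_congr rfl fun k _ => by ring
      rw [e]
      positivity
  · intro f
    set D1 : Fin d → ℝ := fun i => leftInvariantDeriv (X i) f 1
    set D2 : Fin d → Fin d → ℝ := fun j k =>
      leftInvariantDeriv (X j) (leftInvariantDeriv (X k) f) 1
    -- The Taylor remainder with `f 1 * φ` in place of `f 1`, which gives compact support and
    -- changes nothing near 1. The correction `f 1 * ∫ (1 - φ) ∂ν` enters the killing term.
    set h : G → ℝ := fun τ => (f τ - f 1 * φ τ - ∑ i, x i τ * D1 i) -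
      1 / 2 * ∑ j, ∑ k, P j k τ * D2 j k with hh
    have hhc : Continuous h := by
      refine ((f.continuous.sub (continuous_const.mul φ.continuous)).sub
        (continuous_finsetSum _ fun i _ => (x i).continuous.mul continuous_const)).sub
        (continuous_const.mul (continuous_finsetSum _ fun j _ => continuous_finsetSum _ fun k _ =>
          (P j k).continuous.mul continuous_const))
    have hhs : HasCompactSupport h := by
      have hsum : ∀ (g : Fin d → G → ℝ), (∀ i, HasCompactSupport (g i)) →
          HasCompactSupport fun τ => ∑ i, g i τ := fun g hg => by
        have := HasCompactSupport.finset_sum (s := Finset.univ) (fun i _ => hg i)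
        rwa [show ∑ i, g i = fun τ => ∑ i, g i τ from funext fun τ => by simp] at this
      exact ((f.2.2.sub φ.2.2.mul_left).sub (hsum _ fun i => (x i).2.2.mul_right)).sub
        (HasCompactSupport.mul_left (hsum _ fun j => hsum _ fun k => (P j k).2.2.mul_right))
    obtain ⟨hhν, hhlim⟩ := H1 h hhc hhs fun ε hε => by
      filter_upwards [hx.eventually_abs_taylor_le f.2.1 hε, hφ1, hwφ] with τ h1 h2 h3
      rw [h3, hh]
      simp only [h2, mul_one]
      exact h1
    have hsumI : ∀ ρ : Measure G, (∀ j k, Integrable (P j k) ρ) →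
        Integrable (fun τ => ∑ j, ∑ k, P j k τ * D2 j k) ρ ∧
          ∫ τ, ∑ j, ∑ k, P j k τ * D2 j k ∂ρ = ∑ j, ∑ k, (∫ τ, P j k τ ∂ρ) * D2 j k := fun ρ hρ => by
      refine ⟨integrable_finsetSum _ fun j _ => integrable_finsetSum _ fun k _ =>
        (hρ j k).mul_const _, ?_⟩
      rw [integral_finsetSum _ fun j _ => integrable_finsetSum _ fun k _ => (hρ j k).mul_const _]
      refine Finset.sum_congr rfl fun j _ => ?_
      rw [integral_finsetSum _ fun k _ => (hρ j k).mul_const _]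
      exact Finset.sum_congr rfl fun k _ => integral_mul_const _ _
    have hy := hhlim (L f - f 1 * L φ - ∑ i, L (x i) * D1 i -
        1 / 2 * ∑ j, ∑ k, L (P j k) * D2 j k) <| by
      have hlim := (((hL f).sub ((hL φ).const_mul (f 1))).sub (tendsto_finsetSum Finset.univ
        fun i _ => (hL0 (x i) (hx.map_one i)).mul_const (D1 i))).sub
        ((tendsto_finsetSum Finset.univ fun j _ => tendsto_finsetSum Finset.univ fun k _ =>
          (hL0 (P j k) (hP1 j k)).mul_const (D2 j k)).const_mul (1 / 2))
      refine hlim.congr fun t => ?_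
      have hPI := hsumI (ν' t) fun j k => hI (P j k) t
      have hxI : ∀ i ∈ Finset.univ, Integrable (fun τ => x i τ * D1 i) (ν' t) :=
        fun i _ => (hI (x i) t).mul_const _
      rw [hh, integral_sub _ (hPI.1.const_mul _), integral_sub _ (integrable_finsetSum _ hxI),
        integral_sub (hI f t) ((hI φ t).const_mul _), integral_const_mul, integral_const_mul,
        hPI.2, integral_finsetSum _ hxI, hint t f, hint t φ, hφe]
      · simp only [integral_mul_const]
        ring
      · exact (hI f t).sub ((hI φ t).const_mul _)
      · exact ((hI f t).sub ((hI φ t).const_mul _)).sub (integrable_finsetSum _ hxI)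
    have hPI := hsumI ν hPν
    have e : ∫ τ, (f τ - f 1 - ∑ i, x i τ * D1 i) ∂ν =
        ∫ τ, h τ ∂ν + 1 / 2 * (∑ j, ∑ k, (∫ τ, P j k τ ∂ν) * D2 j k) -
          f 1 * ∫ τ, (1 - φ τ) ∂ν := by
      have hadd : Integrable (fun τ => h τ + 1 / 2 * ∑ j, ∑ k, P j k τ * D2 j k) ν :=
        hhν.add (hPI.1.const_mul _)
      rw [← hPI.2, ← integral_const_mul, ← integral_const_mul,
        ← integral_add hhν (hPI.1.const_mul _), ← integral_sub hadd (hφν.const_mul _)]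
      refine integral_congr_ae (ae_of_all _ fun τ => ?_)
      simp only [hh]
      ring
    have e2 : ∑ j, ∑ k, a j k * D2 j k = 1 / 2 * (∑ j, ∑ k, L (P j k) * D2 j k) -
        1 / 2 * ∑ j, ∑ k, (∫ τ, P j k τ ∂ν) * D2 j k := by
      rw [← mul_sub, ← Finset.sum_sub_distrib, Finset.mul_sum]
      refine Finset.sum_congr rfl fun j _ => ?_
      rw [← Finset.sum_sub_distrib, Finset.mul_sum]
      exact Finset.sum_congr rfl fun k _ => by rw [haij]; ring
    rw [e, e2, hy]
    ring

end LevyKhintchine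

/-! ### Uniqueness of the Lévy kernel. -/

section Uniqueness

variable {d : ℕ} {G : Type*} [TopologicalSpace G] [ChartedSpace (EuclideanSpace ℝ (Fin d)) G]

/-- Measures that are finite off the neighbourhoods of a point `e` and do not charge `e` are
determined by the integrals of the functions in `C_c^∞` that vanish near `e`. -/
lemma measure_ext_of_integral_smoothCc [T2Space G] [SecondCountableTopology G]
    [IsManifold (𝓡 d) ∞ G] [MeasurableSpace G] [BorelSpace G] {e : G} {μ μ' : Measure G}
    (h1 : μ {e} = 0) (h1' : μ' {e} = 0) (hμ : ∀ N ∈ 𝓝 e, μ Nᶜ < ⊤) (hμ' : ∀ N ∈ 𝓝 e, μ' Nᶜ < ⊤)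
    (h : ∀ f : SmoothCc d G, (∀ᶠ τ in 𝓝 e, f τ = 0) → ∫ τ, f τ ∂μ = ∫ τ, f τ ∂μ') : μ = μ' := by
  have := ChartedSpace.locallyCompactSpace (EuclideanSpace ℝ (Fin d)) G
  have hopen : ∀ N ∈ 𝓝 e, IsClosed N → ∀ O : Set G, IsOpen O → μ (O ∩ Nᶜ) = μ' (O ∩ Nᶜ) := by
    intro N hN hNc O hO
    have hA : IsOpen (O ∩ Nᶜ) := hO.inter hNc.isOpen_compl
    obtain ⟨f, hfs, hf, hf0⟩ := hA.exists_contMDiff_support_eq (𝓡 d) (n := ⊤)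
    let K : CompactExhaustion G := default
    have hχ : ∀ n, ∃ χ : SmoothCc d G, (∀ τ ∈ K n, χ τ = 1) ∧ ∀ τ, χ τ ∈ Set.Icc (0 : ℝ) 1 :=
      fun n => by
        obtain ⟨χ, hχ1, -, hχ2⟩ := exists_smoothCc_eq_one (d := d) (K.isCompact n) isOpen_univ
          (Set.subset_univ _)
        exact ⟨χ, fun τ hτ => hχ1.self_of_nhdsSet τ hτ, hχ2⟩
    choose χ hχ1 hχ01 using hχ
    -- As `f` is positive exactly on `O ∩ Nᶜ`, these functions tend to its indicator while vanishing
    -- on the neighbourhood `N` of `e`.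
    let g : ℕ → SmoothCc d G := fun n =>
      ⟨fun τ => Real.smoothTransition (n * f τ) * χ n τ,
        (Real.smoothTransition.contDiff.contMDiff.comp (contMDiff_const.mul hf)).mul (χ n).2.1,
        (χ n).2.2.mul_left⟩
    have hg : ∀ n τ, g n τ = Real.smoothTransition (n * f τ) * χ n τ := fun n τ => rfl
    have hgN : ∀ n, ∀ τ ∉ O ∩ Nᶜ, g n τ = 0 := fun n τ hτ => by
      have : f τ = 0 := by rwa [← hfs, Function.notMem_support] at hτ
      rw [hg, this, mul_zero, Real.smoothTransition.zero, zero_mul]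
    have hlim : ∀ ρ : Measure G, (∀ N ∈ 𝓝 e, ρ Nᶜ < ⊤) →
        Tendsto (fun n => ∫ τ, g n τ ∂ρ) atTop (𝓝 (ρ.real (O ∩ Nᶜ))) := by
      intro ρ hρ
      rw [← integral_indicator_one hA.measurableSet]
      refine tendsto_integral_of_dominated_convergence (Set.indicator (O ∩ Nᶜ) 1)
        (fun n => (g n).continuous.aestronglyMeasurable) ?_ (fun n => ae_of_all _ fun τ => ?_)
        (ae_of_all _ fun τ => ?_)
      · exact (integrable_indicator_iff hA.measurableSet).2 (integrableOn_const
          ((measure_mono Set.inter_subset_right).trans_lt (hρ N hN)).ne)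
      · by_cases hτ : τ ∈ O ∩ Nᶜ
        · rw [Set.indicator_of_mem hτ, hg, Real.norm_eq_abs, abs_of_nonneg (mul_nonneg
            (Real.smoothTransition.nonneg _) (hχ01 n τ).1)]
          exact mul_le_one₀ (Real.smoothTransition.le_one _) (hχ01 n τ).1 (hχ01 n τ).2
        · rw [Set.indicator_of_notMem hτ, hgN n τ hτ, norm_zero]
      · by_cases hτ : τ ∈ O ∩ Nᶜ
        · rw [Set.indicator_of_mem hτ]
          refine tendsto_const_nhds.congr' ?_
          have hfτ : 0 < f τ := (hf0 τ).lt_of_ne' (by rwa [← hfs] at hτ)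
          obtain ⟨N₁, hN₁⟩ := K.exists_mem τ
          obtain ⟨N₂, hN₂⟩ := exists_nat_ge (f τ)⁻¹
          filter_upwards [eventually_ge_atTop N₁, eventually_ge_atTop N₂] with n hn hn'
          have h1 : 1 ≤ (n : ℝ) * f τ :=
            (inv_le_iff_one_le_mul₀ hfτ).1 (hN₂.trans (by exact_mod_cast hn'))
          rw [hg, Real.smoothTransition.one_of_one_le h1, hχ1 n τ (K.subset hn hN₁)]
          simp
        · rw [Set.indicator_of_notMem hτ]
          exact tendsto_const_nhds.congr fun n => (hgN n τ hτ).symm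
    have hreal : μ.real (O ∩ Nᶜ) = μ'.real (O ∩ Nᶜ) :=
      tendsto_nhds_unique (hlim μ hμ) ((hlim μ' hμ').congr fun n => (h (g n) (by
        filter_upwards [hN] with τ hτ
        exact hgN n τ fun h => h.2 hτ)).symm)
    exact (measureReal_eq_measureReal_iff
      ((measure_mono Set.inter_subset_right).trans_lt (hμ N hN)).ne
      ((measure_mono Set.inter_subset_right).trans_lt (hμ' N hN)).ne).1 hreal
  have hres : ∀ N ∈ 𝓝 e, IsClosed N → μ.restrict Nᶜ = μ'.restrict Nᶜ := by
    intro N hN hNc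
    have : IsFiniteMeasure (μ.restrict Nᶜ) := ⟨by simpa using hμ N hN⟩
    refine ext_of_generate_finite {O | IsOpen O} (BorelSpace.measurable_eq (α := G))
      isPiSystem_isOpen (fun O hO => ?_) ?_
    · rw [Measure.restrict_apply hO.measurableSet, Measure.restrict_apply hO.measurableSet]
      exact hopen N hN hNc O hO
    · simpa using hopen N hN hNc Set.univ isOpen_univ
  -- Complements of a countable closed neighbourhood basis exhaust the complement of `{e}`, so the
  -- restrictions glue.
  obtain ⟨N, hN, hbasis⟩ := (closed_nhds_basis e).exists_antitone_subbasis
  have hU : ⋃ n, (N n)ᶜ = ({e} : Set G)ᶜ := by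
    ext τ
    simp only [Set.mem_iUnion, Set.mem_compl_iff, Set.mem_singleton_iff]
    refine ⟨fun ⟨n, hn⟩ h => hn (h ▸ mem_of_mem_nhds (hN n).1), fun hτ => ?_⟩
    obtain ⟨n, -, hn⟩ := hbasis.toHasBasis.mem_iff.1 (isOpen_compl_singleton.mem_nhds (Ne.symm hτ))
    exact ⟨n, fun h => hn h rfl⟩
  have hrest := Measure.restrict_iUnion_congr.2 fun n => hres (N n) (hN n).1 (hN n).2
  rw [hU] at hrest
  have hself : ∀ ρ : Measure G, ρ {e} = 0 → ρ.restrict {e}ᶜ = ρ := fun ρ hρ =>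
    Measure.restrict_eq_self_of_ae_mem (s := {e}ᶜ) (compl_mem_ae_iff.2 hρ)
  rwa [hself μ h1, hself μ' h1'] at hrest

variable [Group G]

lemma leftInvariantDeriv_eventually_eq_zero (v : GroupLieAlgebra (𝓡 d) G) {f : G → ℝ} {g : G}
    (hf : ∀ᶠ τ in 𝓝 g, f τ = 0) : ∀ᶠ τ in 𝓝 g, leftInvariantDeriv v f τ = 0 := by
  filter_upwards [hf.eventually_nhds] with τ hτ
  have : f =ᶠ[𝓝 τ] fun _ => (0 : ℝ) := hτ
  rw [leftInvariantDeriv, this.mfderiv_eq, mfderiv_const]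
  rfl

lemma IsAssociatedLevyKernel.apply_eq_integral [MeasurableSpace G]
    {X : Module.Basis (Fin d) ℝ (GroupLieAlgebra (𝓡 d) G)} {x : Fin d → SmoothCc d G}
    {A : SmoothCc d G → G → ℝ} {μ : G → Measure G}
    (hμ : IsAssociatedLevyKernel X x A μ) {g : G} {f : SmoothCc d G}
    (hf : ∀ᶠ τ in 𝓝 g, f τ = 0) : A f g = ∫ τ, f (g * τ) ∂(μ g) := by
  obtain ⟨-, c, b, a, -, -, h⟩ := hμ
  have h1 : ∀ i, leftInvariantDeriv (X i) f g = 0 := fun i =>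
    (leftInvariantDeriv_eventually_eq_zero (X i) hf).self_of_nhds
  have h2 : ∀ j k, leftInvariantDeriv (X j) (leftInvariantDeriv (X k) f) g = 0 := fun j k =>
    (leftInvariantDeriv_eventually_eq_zero (X j)
      (leftInvariantDeriv_eventually_eq_zero (X k) hf)).self_of_nhds
  rw [h f g]
  simp [h1, h2, hf.self_of_nhds]

variable [LieGroup (𝓡 d) ∞ G]

/-- The left translate `τ ↦ f (g τ)` in `C_c^∞(G)`. -/
def SmoothCc.mulLeft (g : G) (f : SmoothCc d G) : SmoothCc d G :=
  ⟨fun τ => f (g * τ), f.2.1.comp contMDiff_mul_left, by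
    have : IsTopologicalGroup G := topologicalGroup_of_lieGroup (𝓡 d) ∞
    exact HasCompactSupport.comp_homeomorph f.2.2 (Homeomorph.mulLeft g)⟩

lemma SmoothCc.mulLeft_apply (g : G) (f : SmoothCc d G) (τ : G) : f.mulLeft g τ = f (g * τ) := rfl

lemma SmoothCc.leftInvariantDeriv_mulLeft (v : GroupLieAlgebra (𝓡 d) G) (g : G)
    (f : SmoothCc d G) :
    leftInvariantDeriv v (f.mulLeft g) = fun τ => leftInvariantDeriv v f (g * τ) :=
  leftInvariantDeriv_comp_mul_left v (f.2.1.mdifferentiable (by simp)) g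

lemma SmoothCc.leftInvariantDeriv_leftInvariantDeriv_mulLeft (v w : GroupLieAlgebra (𝓡 d) G)
    (g : G) (f : SmoothCc d G) :
    leftInvariantDeriv v (leftInvariantDeriv w (f.mulLeft g)) =
      fun τ => leftInvariantDeriv v (leftInvariantDeriv w f) (g * τ) := by
  rw [leftInvariantDeriv_mulLeft]
  exact leftInvariantDeriv_comp_mul_left v
    ((contMDiff_leftInvariantDeriv_two w f.2.1).mdifferentiable (by simp)) g

lemma SmoothCc.eventually_mulLeft_eq_zero {g h : G} {f : SmoothCc d G}
    (hf : ∀ᶠ τ in 𝓝 (g * h), f τ = 0) : ∀ᶠ τ in 𝓝 h, f.mulLeft g τ = 0 := by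
  have : IsTopologicalGroup G := topologicalGroup_of_lieGroup (𝓡 d) ∞
  exact (continuous_const_mul g).tendsto h hf

variable [MeasurableSpace G] [BorelSpace G] {X : Module.Basis (Fin d) ℝ (GroupLieAlgebra (𝓡 d) G)}
  {U : Set G} {x : Fin d → SmoothCc d G} {A : SmoothCc d G → G → ℝ} {μ μ' : G → Measure G}

namespace IsAssociatedLevyKernel

lemma integrable_mulLeft (hμ : IsAssociatedLevyKernel X x A μ) (hx : IsCanonicalCoordinates X U x)
    {g : G} {f : SmoothCc d G} (hf : ∀ᶠ τ in 𝓝 g, f τ = 0) :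
    Integrable (fun τ => f (g * τ)) (μ g) := by
  obtain ⟨C, -, hC⟩ := f.exists_bound
  exact integrable_of_eventually_eq_zero (fun N hN => (hμ.1 g).measure_compl_lt_top hx hN)
    (f.mulLeft g).continuous (fun τ => hC _)
    (SmoothCc.eventually_mulLeft_eq_zero (by rwa [mul_one]))

/-- A test function vanishing near 1 becomes, after translation by `g⁻¹`, one vanishing near `g`;
its integral against either measure is then a value of `A`. -/
lemma eq [T2Space G] [SecondCountableTopology G] (hx : IsCanonicalCoordinates X U x)
    (hμ : IsAssociatedLevyKernel X x A μ) (hμ' : IsAssociatedLevyKernel X x A μ') : μ = μ' := by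
  funext g
  refine measure_ext_of_integral_smoothCc (d := d) (hμ.1 g).singleton_one
    (hμ'.1 g).singleton_one
    (fun N hN => (hμ.1 g).measure_compl_lt_top hx hN)
    (fun N hN => (hμ'.1 g).measure_compl_lt_top hx hN) fun f hf => ?_
  have hf' : ∀ᶠ τ in 𝓝 g, f.mulLeft g⁻¹ τ = 0 :=
    SmoothCc.eventually_mulLeft_eq_zero (by rwa [inv_mul_cancel])
  have h := (hμ.apply_eq_integral hf').symm.trans (hμ'.apply_eq_integral hf')
  simpa only [SmoothCc.mulLeft_apply, inv_mul_cancel_left] using h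

end IsAssociatedLevyKernel

end Uniqueness

/-! ### Existence of the kernel by left translation. -/

section Generator

lemma tendsto_generator {G : Type*} [TopologicalSpace G] [MeasurableSpace G]
    {p : ℝ≥0 → Kernel G G} {f : C₀(G, ℝ)} (hf : f ∈ generatorDomain p) (g : G) :
    Tendsto (fun t : ℝ≥0 => (t : ℝ)⁻¹ * (∫ τ, f τ ∂(p t g) - f g)) (𝓝[>] 0)
      (𝓝 (generator p f g)) := by
  rw [generator, dif_pos hf]
  exact hf.choose_spec.tendsto_at g

variable {d : ℕ} {G : Type*} [TopologicalSpace G] [T2Space G] [SecondCountableTopology G]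
  [ChartedSpace (EuclideanSpace ℝ (Fin d)) G] [Group G] [LieGroup (𝓡 d) ∞ G]
  [MeasurableSpace G] [BorelSpace G] {X : Module.Basis (Fin d) ℝ (GroupLieAlgebra (𝓡 d) G)}
  {U : Set G} {x : Fin d → SmoothCc d G}

lemma exists_isAssociatedLevyKernel (hx : IsCanonicalCoordinates X U x) {p : ℝ≥0 → Kernel G G}
    (hp : ∀ t, IsMarkovKernel (p t)) (hdom : ∀ f : SmoothCc d G, f.toC0 ∈ generatorDomain p) :
    ∃ μ : G → Measure G, IsAssociatedLevyKernel X x (fun f => generator p f.toC0) μ := by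
  have : IsTopologicalGroup G := topologicalGroup_of_lieGroup (𝓡 d) ∞
  have hloc : ∀ g : G, ∃ ν : Measure G, IsLevyMeasure X ν ∧
      ∃ (c : ℝ) (b : Fin d → ℝ) (a : Matrix (Fin d) (Fin d) ℝ), 0 ≤ c ∧ a.PosSemidef ∧
        ∀ f : SmoothCc d G, generator p (f.mulLeft g⁻¹).toC0 g =
          -c * f 1 + ∑ i, b i * leftInvariantDeriv (X i) f 1
          + ∑ j, ∑ k, a j k * leftInvariantDeriv (X j) (leftInvariantDeriv (X k) f) 1
          + ∫ τ, (f τ - f 1 - ∑ i, x i τ * leftInvariantDeriv (X i) f 1) ∂ν := fun g => by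
    have hm : Measurable (g⁻¹ * · : G → G) := (continuous_const_mul g⁻¹).measurable
    have : ∀ t, IsProbabilityMeasure ((p t g).map (g⁻¹ * ·)) := fun t =>
      Measure.isProbabilityMeasure_map hm.aemeasurable
    refine exists_levyKhintchine_of_tendsto hx (fun t => (p t g).map (g⁻¹ * ·))
      (fun f => generator p (f.mulLeft g⁻¹).toC0 g) fun f => ?_
    refine (tendsto_generator (hdom (f.mulLeft g⁻¹)) g).congr fun t => ?_
    rw [integral_map hm.aemeasurable f.continuous.aestronglyMeasurable,
      ← inv_mul_cancel g]
    rfl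
  -- Pointwise choice suffices: no measurability in `g` is demanded of the kernel or the
  -- coefficients.
  choose μ hμ c b a hc ha h using hloc
  refine ⟨μ, hμ, c, b, a, hc, ha, fun f g => ?_⟩
  have hf : (f.mulLeft g).mulLeft g⁻¹ = f := Subtype.ext (funext fun τ => by
    change f (g * (g⁻¹ * τ)) = f τ
    rw [mul_inv_cancel_left])
  have h1 := h g (f.mulLeft g)
  rw [hf] at h1
  simp only [SmoothCc.leftInvariantDeriv_leftInvariantDeriv_mulLeft] at h1
  simpa only [SmoothCc.leftInvariantDeriv_mulLeft, SmoothCc.mulLeft_apply, mul_one]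
    using h1

end Generator

end

theorem mainTheorem11 {d : ℕ} {G : Type*} [TopologicalSpace G] [T2Space G]
    [SecondCountableTopology G] [ChartedSpace (EuclideanSpace ℝ (Fin d)) G] [Group G]
    [LieGroup (𝓡 d) ∞ G] [MeasurableSpace G] [BorelSpace G]
    (X : Module.Basis (Fin d) ℝ (GroupLieAlgebra (𝓡 d) G))
    (U : Set G) (x : Fin d → SmoothCc d G) (hx : IsCanonicalCoordinates X U x)
    (p : ℝ≥0 → Kernel G G) (hp : IsFellerTransition p)
    (hdom : ∀ f : SmoothCc d G, f.toC0 ∈ generatorDomain p) :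
    (∃! μ : G → Measure G, IsAssociatedLevyKernel X x (fun f => generator p f.toC0) μ) ∧
    ∀ μ : G → Measure G, IsAssociatedLevyKernel X x (fun f => generator p f.toC0) μ →
      ∀ (g : G) (f : SmoothCc d G), (∀ᶠ τ in 𝓝 g, f τ = 0) →
        Integrable (fun τ => f (g * τ)) (μ g) ∧
        Tendsto (fun t : ℝ≥0 => (t : ℝ)⁻¹ * ∫ τ, f τ ∂(p t g)) (𝓝[>] 0)
          (𝓝 (∫ τ, f (g * τ) ∂(μ g))) := by
  refine ⟨?_, fun μ hμ g f hf => ⟨hμ.integrable_mulLeft hx hf, ?_⟩⟩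
  · obtain ⟨μ, hμ⟩ := exists_isAssociatedLevyKernel hx hp.isMarkovKernel hdom
    exact ⟨μ, hμ, fun μ' hμ' => hμ'.eq hx hμ⟩
  · rw [← hμ.apply_eq_integral hf]
    refine (tendsto_generator (hdom f) g).congr fun t => ?_
    change (t : ℝ)⁻¹ * (∫ τ, f τ ∂(p t g) - f g) = _
    rw [hf.self_of_nhds, sub_zero]
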